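/- Notation. Let $\mathbb T^n=\mathbb R^n/\mathbb Z^n$ with normalised Lebesgue measure, and let $|k|$ be the Euclidean norm of $k\in\mathbb Z^n$. For multi-indices $\alpha\in\mathbb N_0^n$ put $|\alpha|=\alpha_1+\cdots+\alpha_n$ and $\alpha!=\alpha_1!\cdots\alpha_n!$. For functions on $\mathbb Z^n$ let $\Delta^\alpha=\Delta_1^{\alpha_1}\cdots\Delta_n^{\alpha_n}$, where $\Delta_j\tau(k)=\tau(k+v_j)-\tau(k)$ and $v_j$ is the $j$-th unit vector. For functions on $\mathbb T^n$ let $D_x^{(\alpha)}=D_{x_1}^{(\alpha_1)}\cdots D_{x_n}^{(\alpha_n)}$, where $$D_{x_j}^{(\ell)}=\prod_{m=0}^{\ell-1}\Big(\frac1{2\pi i}\frac{\partial}{\partial x_j}-m\Big),\qquad D_{x_j}^{(0)}=I.$$ A function $\sigma:\mathbb Z^n\times\mathbb T^n\to\mathbb C$ belongs to $S^{\mu}_{\rho,\delta}(\mathbb Z^n\times\mathbb T^n)$ if $\sigma(k,\cdot)\in C^\infty(\mathbb T^n)$ for every $k$ and for all multi-indices $\alpha,\beta$ there is $C_{\alpha,\beta}>0$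 such that $|D_x^{(\beta)}\Delta_k^\alpha\sigma(k,x)|\le C_{\alpha,\beta}(1+|k|)^{\mu-\rho|\alpha|+\delta|\beta|}$ for all $k\in\mathbb Z^n$, $x\in\mathbb T^n$. A function $a:\mathbb Z^n\times\mathbb Z^n\times\mathbb T^n\to\mathbb C$ belongs to $\mathcal A^{\mu_1,\mu_2}_{\rho,\delta}(\mathbb Z^n\times\mathbb Z^n\times\mathbb T^n)$ if $a(k,l,\cdot)\in C^\infty(\mathbb T^n)$ for all $k,l$ and for all multi-indices $\alpha,\beta,\gamma$ there are $C_{\alpha,\beta,\gamma}>0$ and an integer $0\le J\le|\gamma|$ such that $$|D_y^{(\gamma)}\Delta_k^\alpha\Delta_l^\beta a(k,l,y)|\le C_{\alpha,\beta,\gamma}(1+|k|)^{\mu_1-\rho|\alpha|+\delta J}(1+|l|)^{\mu_2-\rho|\beta|+\delta(|\gamma|-J)}$$ for all $k,l\in\mathbb Z^n$, $y\in\mathbb T^n$. Theorem. Let $\mu_1,\mu_2\in\mathbb R$, $0\le\delta<\rho\le1$ and $a\in\mathcal A^{\mu_1,\mu_2}_{\rho,\delta}(\mathbb Z^n\times\mathbb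 Z^n\times\mathbb T^n)$, and let $$Af(k)=\sum_{l\in\mathbb Z^n}\int_{\mathbb T^n}e^{2\pi i(k-l)\cdot x}a(k,l,x)f(l)\,dx .$$ Then there is $\sigma_A\in S^{\mu_1+\mu_2}_{\rho,\delta}(\mathbb Z^n\times\mathbb T^n)$ with $A=\mathrm{Op}(\sigma_A)$; that is, for every $f\in\ell^1(\mathbb Z^n)$ (in particular every rapidly decreasing $f$) and every $k\in\mathbb Z^n$ the series defining $Af(k)$ converges absolutely and $$Af(k)=\mathrm{Op}(\sigma_A)f(k):=\int_{\mathbb T^n}e^{2\pi ik\cdot x}\sigma_A(k,x)\widehat f(x)\,dx,\qquad \widehat f(x)=\sum_{k\in\mathbb Z^n}e^{-2\pi ik\cdot x}f(k).$$ Moreover $\sigma_A(k,x)\sim\sum_\alpha\frac1{\alpha!}\Delta_l^\alpha D_x^{(\alpha)}a(k,l,x)\big|_{l=k}$, in the sense that for every $N\in\mathbb N_0$ $$\sigma_A(k,x)-\sum_{|\alpha|<N}\frac1{\alpha!}\Delta_l^\alpha D_x^{(\alpha)}a(k,l,x)\Big|_{l=k}\in S^{\mu_1+\mu_2-N(\rho-\delta)}_{\rho,\delta}(\mathbb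 Z^n\times\mathbb T^n).$$ -/

import Mathlib

open scoped ContDiff

namespace PsiDO

noncomputable section

/-- Normalised Haar (Lebesgue) measure on the torus `𝕋ⁿ = ℝⁿ/ℤⁿ`. -/
def torusMeasure (n : ℕ) : MeasureTheory.Measure (UnitAddTorus (Fin n)) :=
  MeasureTheory.Measure.pi fun _ => AddCircle.haarAddCircle

/-- The length `|α| = α₁ + ⋯ + αₙ` of a multi-index. -/
def mlen {n : ℕ} (α : Fin n → ℕ) : ℕ := ∑ j, α j

/-- The factorial `α! = α₁! ⋯ αₙ!` of a multi-index. -/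
def mfact {n : ℕ} (α : Fin n → ℕ) : ℕ := ∏ j, (α j).factorial

/-- The finite set of multi-indices `α` with `|α| < N`. -/
def multiLT (n N : ℕ) : Finset (Fin n → ℕ) :=
  (Fintype.piFinset fun _ : Fin n => Finset.range N).filter fun α => mlen α < N

theorem mem_multiLT {n N : ℕ} (α : Fin n → ℕ) : α ∈ multiLT n N ↔ mlen α < N := by
  simp only [multiLT, Finset.mem_filter, Fintype.mem_piFinset, Finset.mem_range,
    and_iff_right_iff_imp]
  intro h j
  exact lt_of_le_of_lt (Finset.single_le_sum (fun i _ => Nat.zero_le (α i)) (Finset.mem_univ j)) h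

/-- The weight `1 + |k|`, with `|k|` the Euclidean length of `k ∈ ℤⁿ`. -/
def wt {n : ℕ} (k : Fin n → ℤ) : ℝ := 1 + Real.sqrt (∑ j, (k j : ℝ) ^ 2)

/-- `Δ^α = Δ₁^{α₁} ⋯ Δₙ^{αₙ}` on functions on `ℤⁿ`, where `Δⱼ τ (k) = τ (k + vⱼ) - τ k` and
`vⱼ` is the `j`-th unit vector. -/
def diff {n : ℕ} (α : Fin n → ℕ) (τ : (Fin n → ℤ) → ℂ) : (Fin n → ℤ) → ℂ :=
  (List.finRange n).foldr (fun j g => (fwdDiff (Pi.single j (1 : ℤ)))^[α j] g) τ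

/-- `f ∈ C^∞(𝕋ⁿ)`: the periodic lift of `f` to `ℝⁿ` is smooth. -/
def SmoothTorus {n : ℕ} (f : UnitAddTorus (Fin n) → ℂ) : Prop :=
  ContDiff ℝ ∞ fun x : Fin n → ℝ => f fun j => (x j : UnitAddCircle)

/-- `D_{x_j} = (2πi)⁻¹ ∂/∂x_j` on functions on the torus. -/
def pd {n : ℕ} (j : Fin n) (f : UnitAddTorus (Fin n) → ℂ) : UnitAddTorus (Fin n) → ℂ :=
  fun x => (2 * Real.pi * Complex.I)⁻¹ *
    deriv (fun t : ℝ => f (x + Pi.single j (t : UnitAddCircle))) 0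

/-- `D_{x_j}^{(ℓ)} = ∏_{m=0}^{ℓ-1} (D_{x_j} - m)`; in particular `D_{x_j}^{(0)} = I`. -/
def pdFall {n : ℕ} (j : Fin n) : ℕ → (UnitAddTorus (Fin n) → ℂ) → UnitAddTorus (Fin n) → ℂ
  | 0, f => f
  | m + 1, f => fun x => pd j (pdFall j m f) x - (m : ℂ) * pdFall j m f x

/-- `D_x^{(α)} = D_{x_1}^{(α₁)} ⋯ D_{x_n}^{(αₙ)}`. -/
def mpd {n : ℕ} (α : Fin n → ℕ) (f : UnitAddTorus (Fin n) → ℂ) : UnitAddTorus (Fin n) → ℂ :=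
  (List.finRange n).foldr (fun j g => pdFall j (α j) g) f

/-- The symbol class `S^μ_{ρ,δ}(ℤⁿ × 𝕋ⁿ)`. -/
def IsSymbol {n : ℕ} (μ ρ δ : ℝ) (σ : (Fin n → ℤ) → UnitAddTorus (Fin n) → ℂ) : Prop :=
  (∀ k, SmoothTorus (σ k)) ∧
  ∀ α β : Fin n → ℕ, ∃ C : ℝ, 0 < C ∧ ∀ (k : Fin n → ℤ) (x : UnitAddTorus (Fin n)),
    ‖mpd β (fun y => diff α (fun k' => σ k' y) k) x‖ ≤
      C * wt k ^ (μ - ρ * (mlen α : ℝ) + δ * (mlen β : ℝ))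

/-- The amplitude class `𝒜^{μ₁,μ₂}_{ρ,δ}(ℤⁿ × ℤⁿ × 𝕋ⁿ)`. -/
def IsAmplitude {n : ℕ} (μ₁ μ₂ ρ δ : ℝ)
    (a : (Fin n → ℤ) → (Fin n → ℤ) → UnitAddTorus (Fin n) → ℂ) : Prop :=
  (∀ k l, SmoothTorus (a k l)) ∧
  ∀ α β γ : Fin n → ℕ, ∃ C : ℝ, 0 < C ∧ ∃ J : ℕ, J ≤ mlen γ ∧
    ∀ (k l : Fin n → ℤ) (y : UnitAddTorus (Fin n)),
      ‖mpd γ (fun z => diff α (fun k' => diff β (fun l' => a k' l' z) l) k) y‖ ≤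
        C * wt k ^ (μ₁ - ρ * (mlen α : ℝ) + δ * (J : ℝ)) *
          wt l ^ (μ₂ - ρ * (mlen β : ℝ) + δ * ((mlen γ : ℝ) - (J : ℝ)))

/-- The lattice Fourier transform `f̂(x) = ∑_k e^{-2πi k·x} f(k)`. -/
def latticeFourier {n : ℕ} (f : (Fin n → ℤ) → ℂ) (x : UnitAddTorus (Fin n)) : ℂ :=
  ∑' k : Fin n → ℤ, UnitAddTorus.mFourier (-k) x * f k

/-- `Op(σ) f (k) = ∫_{𝕋ⁿ} e^{2πi k·x} σ(k,x) f̂(x) dx`. -/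
def opSymbol {n : ℕ} (σ : (Fin n → ℤ) → UnitAddTorus (Fin n) → ℂ) (f : (Fin n → ℤ) → ℂ)
    (k : Fin n → ℤ) : ℂ :=
  ∫ x, UnitAddTorus.mFourier k x * σ k x * latticeFourier f x ∂(torusMeasure n)

/-- The summand `∫_{𝕋ⁿ} e^{2πi (k-l)·x} a(k,l,x) f(l) dx` of the amplitude operator. -/
def ampTerm {n : ℕ} (a : (Fin n → ℤ) → (Fin n → ℤ) → UnitAddTorus (Fin n) → ℂ)
    (f : (Fin n → ℤ) → ℂ) (k l : Fin n → ℤ) : ℂ :=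
  ∫ x, UnitAddTorus.mFourier (k - l) x * a k l x * f l ∂(torusMeasure n)

/-- The amplitude operator `A f (k) = ∑_l ∫_{𝕋ⁿ} e^{2πi (k-l)·x} a(k,l,x) f(l) dx`. -/
def opAmplitude {n : ℕ} (a : (Fin n → ℤ) → (Fin n → ℤ) → UnitAddTorus (Fin n) → ℂ)
    (f : (Fin n → ℤ) → ℂ) (k : Fin n → ℤ) : ℂ :=
  ∑' l : Fin n → ℤ, ampTerm a f k l

/-- The partial sum `∑_{|α| < N} (1/α!) Δ_l^α D_x^{(α)} a(k,l,x) |_{l = k}`. -/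
def ampExpansion {n : ℕ} (a : (Fin n → ℤ) → (Fin n → ℤ) → UnitAddTorus (Fin n) → ℂ) (N : ℕ)
    (k : Fin n → ℤ) (x : UnitAddTorus (Fin n)) : ℂ :=
  ∑ α ∈ multiLT n N, (1 / (mfact α : ℂ)) * diff α (fun l => mpd α (a k l) x) k

end

end PsiDO

/-!
Write `c(k, l, m)` for the `m`-th Fourier coefficient of `a(k, l, ·)`. Expanding `f̂` and comparing
the coefficients of `f(l)` forces `σ_A(k, x) = ∑_m c(k, k + m, m) e^{2πi m·x}` (`ampSymbol`), and the
series converges with all its derivatives: since `D_x^{(γ)}` multiplies the `m`-th coefficient by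
the falling factorial `m^{(γ)}` (`coef_mpd`), the amplitude estimates with `|γ| ≤ M` give decay of
order `(1 + |m|)^{-M}` at the cost of a factor `max (1 + |k|) (1 + |l|)^{δM}`
(`IsAmplitude.norm_coef_le`), and `δ < 1`.

The expansion is Newton's formula in the frequency variable,
`c(k, k + m, m) = ∑_{|α| < N} (m^{(α)} / α!) Δ_l^α c(k, l, m)|_{l = k} + R_N`: the summand of index
`α` is the `m`-th Fourier coefficient of `(1/α!) Δ_l^α D_x^{(α)} a(k, l, x)|_{l = k}`, so that the
remainder of the symbol has the Fourier coefficients `R_N` (`newtonRem`). If `|m|₁ ≤ (1 + |k|)/2`,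
all lattice points on a path from `k` to `k + m` have weight comparable to `1 + |k|`, and the `N`
differences gain `(1 + |k|)^{-ρN}` against `(1 + |k|)^{δN}` lost to absorb `|m|^N`
(`norm_newtonRem_near`). Otherwise `1 + |m|` dominates every weight and the rapid decay in `m` beats
any power (`norm_newtonRem_far`). Differences in `k` are reduced to this case by the discrete chain
rule along the diagonal (`diff_diagonal`).

Summing `|R_N|` over `m` loses a fixed power `(1 + |k|)^{2nδ}`
(`IsAmplitude.isSymbol_remainder_of_loss`). This is harmless: expand to a larger order `N + L`, for
which the gain exceeds the loss, and note that each additional term is a symbol of the right order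
by the amplitude estimates on the diagonal (`isSymbol_ampTermExp`). The case `N = 0` is the symbol
estimate for `σ_A` itself.
-/

namespace PsiDO

variable {n : ℕ}

/-! ### Multi-indices and iterated differences -/

theorem multiIndex_induction {P : (Fin n → ℕ) → Prop} (h0 : P 0)
    (hs : ∀ α j, P α → P (α + Pi.single j 1)) (α : Fin n → ℕ) : P α := by
  induction h : mlen α generalizing α with
  | zero =>
    have : α = 0 := by
      funext j
      have := Finset.single_le_sum (fun i _ => Nat.zero_le (α i)) (Finset.mem_univ j)
      simp only [mlen] at h
      simp only [Pi.zero_apply]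
      omega
    exact this ▸ h0
  | succ s ih =>
    obtain ⟨j, hj⟩ : ∃ j, α j ≠ 0 := by
      by_contra! hc
      simp [mlen, hc] at h
    have e : α = (α - Pi.single j 1) + Pi.single j 1 := by
      funext i
      rcases eq_or_ne i j with rfl | hi
      · simp only [Pi.add_apply, Pi.sub_apply, Pi.single_eq_same]; omega
      · simp [hi]
    rw [e]
    refine hs _ _ (ih _ ?_)
    rw [e] at h
    simp only [mlen, Pi.add_apply, Finset.sum_add_distrib, Finset.sum_pi_single',
      Finset.mem_univ, if_true] at h ⊢
    omega

@[simp] theorem mlen_zero : mlen (0 : Fin n → ℕ) = 0 := by simp [mlen]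

@[simp] theorem mlen_add (α β : Fin n → ℕ) : mlen (α + β) = mlen α + mlen β := by
  simp [mlen, Finset.sum_add_distrib]

@[simp] theorem mlen_single (j : Fin n) (a : ℕ) : mlen (Pi.single j a) = a := by
  simp [mlen]

/-- The forward difference `Δⱼ` on functions on `ℤⁿ`. -/
abbrev dif (j : Fin n) (τ : (Fin n → ℤ) → ℂ) : (Fin n → ℤ) → ℂ := fwdDiff (Pi.single j (1 : ℤ)) τ

theorem dif_commute (i j : Fin n) : Function.Commute (dif i) (dif j) := by
  intro τ
  funext k
  simp only [dif, fwdDiff, add_right_comm k (Pi.single j (1 : ℤ)) (Pi.single i 1)]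
  ring

theorem foldr_dif_commute (L : List (Fin n)) (α : Fin n → ℕ) (j : Fin n)
    (τ : (Fin n → ℤ) → ℂ) :
    L.foldr (fun i g => (dif i)^[α i] g) (dif j τ) =
      dif j (L.foldr (fun i g => (dif i)^[α i] g) τ) := by
  induction L with
  | nil => rfl
  | cons i L ih =>
    simp only [List.foldr_cons, ih]
    exact ((dif_commute i j).iterate_left (α i)) _

theorem foldr_dif_succ (L : List (Fin n)) (hL : L.Nodup) (α : Fin n → ℕ) (j : Fin n)
    (τ : (Fin n → ℤ) → ℂ) :
    L.foldr (fun i g => (dif i)^[(α + Pi.single j 1 : Fin n → ℕ) i] g) τ =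
      if j ∈ L then dif j (L.foldr (fun i g => (dif i)^[α i] g) τ)
      else L.foldr (fun i g => (dif i)^[α i] g) τ := by
  induction L with
  | nil => simp
  | cons i L ih =>
    obtain ⟨hi, hL⟩ := List.nodup_cons.mp hL
    simp only [List.foldr_cons, ih hL, List.mem_cons]
    rcases eq_or_ne j i with rfl | hij
    · simp only [hi, if_false, true_or, if_true, Pi.add_apply, Pi.single_eq_same]
      rw [Function.iterate_succ_apply']
    · simp only [hij, false_or, Pi.add_apply, Pi.single_eq_of_ne hij.symm, add_zero]
      split_ifs
      · exact ((dif_commute i j).iterate_left (α i)) _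
      · rfl

@[simp] theorem diff_zero (τ : (Fin n → ℤ) → ℂ) : diff 0 τ = τ := by
  unfold diff
  generalize List.finRange n = L
  induction L with
  | nil => rfl
  | cons i L _ => simp

theorem diff_add_single (α : Fin n → ℕ) (j : Fin n) (τ : (Fin n → ℤ) → ℂ) :
    diff (α + Pi.single j 1) τ = dif j (diff α τ) := by
  have := foldr_dif_succ _ (List.nodup_finRange n) α j τ
  rwa [if_pos (List.mem_finRange j)] at this

theorem diff_dif (α : Fin n → ℕ) (j : Fin n) (τ : (Fin n → ℤ) → ℂ) :
    diff α (dif j τ) = dif j (diff α τ) :=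
  foldr_dif_commute _ α j τ

theorem diff_diff (α β : Fin n → ℕ) (τ : (Fin n → ℤ) → ℂ) :
    diff α (diff β τ) = diff (α + β) τ := by
  induction α using multiIndex_induction with
  | h0 => simp
  | hs α j ih => rw [diff_add_single, ih, add_right_comm, diff_add_single]

/-- `Δ^α` is a finite linear combination of translations. -/
theorem diff_eq_sum_shift (α : Fin n → ℕ) :
    ∃ (ι : Type) (_ : Fintype ι) (w : ι → ℂ) (v : ι → Fin n → ℤ),
      ∀ (τ : (Fin n → ℤ) → ℂ) (k : Fin n → ℤ), diff α τ k = ∑ i, w i * τ (k + v i) := by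
  induction α using multiIndex_induction with
  | h0 => exact ⟨Unit, inferInstance, fun _ => 1, fun _ => 0, fun τ k => by simp⟩
  | hs α j ih =>
    obtain ⟨ι, _, w, v, h⟩ := ih
    refine ⟨ι ⊕ ι, inferInstance, Sum.elim w (fun i => - w i),
      Sum.elim (fun i => Pi.single j 1 + v i) v, fun τ k => ?_⟩
    rw [diff_add_single]
    simp only [dif, fwdDiff, h, Fintype.sum_sum_type, Sum.elim_inl, Sum.elim_inr, add_assoc,
      neg_mul, Finset.sum_neg_distrib]
    ring

theorem diff_add (α : Fin n → ℕ) (τ υ : (Fin n → ℤ) → ℂ) (k : Fin n → ℤ) :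
    diff α (fun k => τ k + υ k) k = diff α τ k + diff α υ k := by
  obtain ⟨ι, _, w, v, h⟩ := diff_eq_sum_shift α
  simp only [h, mul_add, Finset.sum_add_distrib]

theorem diff_sub (α : Fin n → ℕ) (τ υ : (Fin n → ℤ) → ℂ) (k : Fin n → ℤ) :
    diff α (fun k => τ k - υ k) k = diff α τ k - diff α υ k := by
  obtain ⟨ι, _, w, v, h⟩ := diff_eq_sum_shift α
  simp only [h, mul_sub, Finset.sum_sub_distrib]

theorem diff_const_mul (α : Fin n → ℕ) (c : ℂ) (τ : (Fin n → ℤ) → ℂ) (k : Fin n → ℤ) :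
    diff α (fun k => c * τ k) k = c * diff α τ k := by
  obtain ⟨ι, _, w, v, h⟩ := diff_eq_sum_shift α
  simp only [h, Finset.mul_sum]
  exact Finset.sum_congr rfl fun i _ => by ring

theorem diff_finset_sum {ι : Type*} (s : Finset ι) (α : Fin n → ℕ)
    (τ : ι → (Fin n → ℤ) → ℂ) (k : Fin n → ℤ) :
    diff α (fun k => ∑ i ∈ s, τ i k) k = ∑ i ∈ s, diff α (τ i) k := by
  obtain ⟨ι, _, w, v, h⟩ := diff_eq_sum_shift α
  simp only [h, Finset.mul_sum]
  rw [Finset.sum_comm]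

theorem diff_comp_add (α : Fin n → ℕ) (τ : (Fin n → ℤ) → ℂ) (m k : Fin n → ℤ) :
    diff α (fun l => τ (l + m)) k = diff α τ (k + m) := by
  obtain ⟨ι, _, w, v, h⟩ := diff_eq_sum_shift α
  simp only [h, add_right_comm]

/-- Partial differences in two different groups of variables commute. -/
theorem diff_diff_comm (α β : Fin n → ℕ) (F : (Fin n → ℤ) → (Fin n → ℤ) → ℂ)
    (k l : Fin n → ℤ) :
    diff α (fun k' => diff β (fun l' => F k' l') l) k =
      diff β (fun l' => diff α (fun k' => F k' l') k) l := by
  obtain ⟨ι, _, w, v, h⟩ := diff_eq_sum_shift α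
  obtain ⟨ι', _, w', v', h'⟩ := diff_eq_sum_shift β
  simp only [h, h', Finset.mul_sum]
  rw [Finset.sum_comm]
  exact Finset.sum_congr rfl fun i _ => Finset.sum_congr rfl fun i _ => by ring

/-- Discrete chain rule along the diagonal: since
`Δⱼ (g k k) = (Δ_{k,j} g + Δ_{l,j} g + Δ_{k,j} Δ_{l,j} g)|_{l = k}`, the difference `Δ^α` of
`k ↦ g k k` is a sum of mixed differences of `g` of total order at least `|α|`. -/
theorem diff_diagonal (α : Fin n → ℕ) :
    ∃ (ι : Type) (_ : Fintype ι) (p q : ι → Fin n → ℕ), (∀ i, mlen α ≤ mlen (p i) + mlen (q i)) ∧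
      ∀ (g : (Fin n → ℤ) → (Fin n → ℤ) → ℂ) (k : Fin n → ℤ), diff α (fun k => g k k) k =
        ∑ i, diff (p i) (fun k' => diff (q i) (fun l' => g k' l') k) k := by
  induction α using multiIndex_induction with
  | h0 => exact ⟨Unit, inferInstance, fun _ => 0, fun _ => 0, by simp, fun g k => by simp⟩
  | hs α j ih =>
    obtain ⟨ι, _, p, q, hpq, h⟩ := ih
    let e : Fin n → ℕ := Pi.single j 1
    refine ⟨ι ⊕ (ι ⊕ ι), inferInstance,
      Sum.elim (fun i => p i + e) (Sum.elim p (fun i => p i + e)),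
      Sum.elim q (Sum.elim (fun i => q i + e) (fun i => q i + e)), ?_, fun g k => ?_⟩
    · rintro (i | i | i) <;> have := hpq i <;> simp [e] <;> omega
    · have hk : ∀ (G : (Fin n → ℤ) → (Fin n → ℤ) → ℂ) (p q : Fin n → ℕ),
          diff (p + e) (fun k' => diff q (fun l' => G k' l') k) k =
            diff p (fun k' => diff q (fun l' => G (k' + Pi.single j 1) l' - G k' l') k) k := by
        intro G p q
        rw [diff_add_single, ← diff_dif]
        congr 1
        funext k'
        exact (diff_sub _ _ _ _).symm
      have hl : ∀ (G : (Fin n → ℤ) → (Fin n → ℤ) → ℂ) (p q : Fin n → ℕ),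
          diff p (fun k' => diff (q + e) (fun l' => G k' l') k) k =
            diff p (fun k' => diff q (fun l' => G k' (l' + Pi.single j 1) - G k' l') k) k := by
        intro G p q
        congr 1
        funext k'
        rw [diff_add_single, ← diff_dif]
        rfl
      simp only [Fintype.sum_sum_type, Sum.elim_inl, Sum.elim_inr, ← Finset.sum_add_distrib]
      rw [diff_add_single, ← diff_dif]
      have := h (fun k l => g (k + Pi.single j 1) (l + Pi.single j 1) - g k l) k
      erw [this]
      refine Finset.sum_congr rfl fun i _ => ?_
      rw [hk, hk, hl, hl, ← diff_add, ← diff_add]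
      congr 1
      funext k'
      rw [← diff_add, ← diff_add]
      congr 1
      funext l'
      ring

/-! ### Lattice weights -/

/-- The `ℓ¹` length of a lattice point. -/
def lone (m : Fin n → ℤ) : ℕ := ∑ j, (m j).natAbs

theorem wt_eq_norm (k : Fin n → ℤ) :
    wt k = 1 + ‖(WithLp.toLp 2 fun j => (k j : ℝ) : EuclideanSpace ℝ (Fin n))‖ := by
  simp [wt, EuclideanSpace.norm_eq]

theorem one_le_wt (k : Fin n → ℤ) : 1 ≤ wt k := by
  simp only [wt, le_add_iff_nonneg_right]; positivity

theorem wt_pos (k : Fin n → ℤ) : 0 < wt k := one_pos.trans_le (one_le_wt k)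

theorem one_add_abs_le_wt (m : Fin n → ℤ) (j : Fin n) : 1 + |(m j : ℝ)| ≤ wt m := by
  rw [wt_eq_norm]
  gcongr
  simpa using PiLp.norm_apply_le (p := 2)
    (WithLp.toLp 2 fun j => (m j : ℝ) : EuclideanSpace ℝ (Fin n)) j

theorem wt_add_le (k m : Fin n → ℤ) : wt (k + m) ≤ wt k + (wt m - 1) := by
  have := norm_add_le (WithLp.toLp 2 fun j => (k j : ℝ) : EuclideanSpace ℝ (Fin n))
    (WithLp.toLp 2 fun j => (m j : ℝ))
  have e : (WithLp.toLp 2 fun j => (((k + m) j : ℤ) : ℝ) : EuclideanSpace ℝ (Fin n)) =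
    WithLp.toLp 2 (fun j => (k j : ℝ)) + WithLp.toLp 2 fun j => (m j : ℝ) := by
    ext j; simp
  rw [wt_eq_norm, wt_eq_norm, wt_eq_norm, e]
  linarith

theorem wt_le_one_add_lone (m : Fin n → ℤ) : wt m ≤ 1 + lone m := by
  have h : ∑ j, (m j : ℝ) ^ 2 ≤ (lone m : ℝ) ^ 2 := by
    have : ∑ j, (m j : ℝ) ^ 2 = ∑ j, ((m j).natAbs : ℝ) ^ 2 :=
      Finset.sum_congr rfl fun j _ => by rw [Nat.cast_natAbs, Int.cast_abs, sq_abs]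
    rw [this, lone, Nat.cast_sum]
    exact Finset.sum_sq_le_sq_sum_of_nonneg fun i _ => by positivity
  simp only [wt]
  gcongr
  exact Real.sqrt_le_iff.mpr ⟨by positivity, h⟩

theorem wt_add_le_lone (k m : Fin n → ℤ) : wt (k + m) ≤ wt k + lone m :=
  (wt_add_le k m).trans (by linarith [wt_le_one_add_lone m])

theorem lone_neg (m : Fin n → ℤ) : lone (-m) = lone m := by simp [lone]

theorem wt_le_add_lone (k m : Fin n → ℤ) : wt k ≤ wt (k + m) + lone m := by
  have := wt_add_le_lone (k + m) (-m)
  rwa [add_neg_cancel_right, lone_neg] at this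

theorem lone_le (m : Fin n → ℤ) : (lone m : ℝ) ≤ n * wt m := by
  rw [lone, Nat.cast_sum]
  refine (Finset.sum_le_card_nsmul _ _ (wt m) fun j _ => ?_).trans (by simp)
  have := one_add_abs_le_wt m j
  rw [Nat.cast_natAbs, Int.cast_abs]
  linarith

theorem wt_rpow_le (k : Fin n → ℤ) {s t : ℝ} (h : s ≤ t) : wt k ^ s ≤ wt k ^ t :=
  Real.rpow_le_rpow_of_exponent_le (one_le_wt k) h

/-- The bound `∏ⱼ (1 + |m_j|)² ≤ (1 + |m|) ^ (2 n)` reduces this to a product of `n` convergent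
series over `ℤ`. -/
theorem summable_wt (n : ℕ) : Summable fun m : Fin n → ℤ => (wt m ^ (2 * n))⁻¹ := by
  let f : ℤ → ℝ := fun x => ((1 + |(x : ℝ)|) ^ 2)⁻¹
  have hf0 : ∀ x, 0 ≤ f x := fun x => by positivity
  have hf : Summable f := by
    have h2 : Summable fun x : ℤ => ((x : ℝ) ^ 2)⁻¹ := by
      simpa using Real.summable_one_div_int_pow.mpr (by norm_num : 1 < 2)
    refine Summable.of_norm_bounded_eventually h2 ?_
    filter_upwards [(Set.finite_singleton (0 : ℤ)).compl_mem_cofinite] with x hx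
    have hx' : 0 < |(x : ℝ)| := by simpa using hx
    rw [Real.norm_of_nonneg (hf0 x), ← sq_abs (x : ℝ)]
    simp only [f]
    gcongr
    linarith
  have hprod : Summable fun m : Fin n → ℤ => ∏ j, f (m j) := by
    refine summable_of_sum_le (c := (∑' x, f x) ^ n)
      (fun m => Finset.prod_nonneg fun j _ => hf0 _) fun s => ?_
    calc ∑ m ∈ s, ∏ j, f (m j)
        ≤ ∑ m ∈ Fintype.piFinset fun j => s.image fun m => m j, ∏ j, f (m j) := by
          refine Finset.sum_le_sum_of_subset_of_nonneg (fun m hm => ?_)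
            fun m _ _ => Finset.prod_nonneg fun j _ => hf0 _
          exact Fintype.mem_piFinset.mpr fun j => Finset.mem_image_of_mem _ hm
      _ = ∏ j, ∑ x ∈ s.image fun m => m j, f x := (Finset.prod_univ_sum _ _).symm
      _ ≤ ∏ j : Fin n, ∑' x, f x := by
          refine Finset.prod_le_prod (fun j _ => Finset.sum_nonneg fun x _ => hf0 x) fun j _ => ?_
          exact hf.sum_le_tsum _ fun x _ => hf0 x
      _ = _ := by simp
  refine hprod.of_nonneg_of_le (fun m => by have := wt_pos m; positivity) fun m => ?_
  simp only [f]
  rw [Finset.prod_inv_distrib]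
  gcongr
  calc ∏ j, (1 + |(m j : ℝ)|) ^ 2 ≤ ∏ j : Fin n, wt m ^ 2 := by
        gcongr with j; exact one_add_abs_le_wt m j
    _ = wt m ^ (2 * n) := by simp [pow_mul]

/-! ### Falling factorials -/

/-- The falling factorial `x (x - 1) ⋯ (x - a + 1)` of an integer, as a complex number. -/
def fall (a : ℕ) (x : ℤ) : ℂ := ∏ i ∈ Finset.range a, ((x : ℂ) - i)

/-- The multivariate falling factorial `m^{(γ)}`, the symbol of `D_x^{(γ)}`. -/
def mfall (γ : Fin n → ℕ) (m : Fin n → ℤ) : ℂ := ∏ j, fall (γ j) (m j)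

theorem fall_succ (a : ℕ) (x : ℤ) : fall (a + 1) x = fall a x * ((x : ℂ) - a) := by
  simp [fall, Finset.prod_range_succ]

theorem fall_succ_add_one (a : ℕ) (x : ℤ) :
    fall (a + 1) (x + 1) = ((x : ℂ) + 1) * fall a x := by
  rw [fall, Finset.prod_range_succ', fall, mul_comm]
  congr 1
  · push_cast; ring
  · exact Finset.prod_congr rfl fun i _ => by push_cast; ring

@[simp] theorem mfall_zero (m : Fin n → ℤ) : mfall 0 m = 1 := by simp [mfall, fall]

theorem norm_mfall_le (γ : Fin n → ℕ) :
    ∃ C : ℝ, 0 < C ∧ ∀ m : Fin n → ℤ, ‖mfall γ m‖ ≤ C * wt m ^ mlen γ := by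
  refine ⟨∏ j, ((1 + γ j : ℝ)) ^ γ j, by positivity, fun m => ?_⟩
  rw [mlen, ← Finset.prod_pow_eq_pow_sum, ← Finset.prod_mul_distrib, mfall, norm_prod]
  gcongr with j
  rw [fall, norm_prod, ← mul_pow, ← Finset.card_range (γ j), ← Finset.prod_const,
    Finset.card_range]
  gcongr with i hi
  have hi' : (i : ℝ) ≤ γ j := by exact_mod_cast (Finset.mem_range.mp hi).le
  have h1 := one_add_abs_le_wt m j
  calc ‖((m j : ℂ) - i)‖ ≤ ‖(m j : ℂ)‖ + ‖(i : ℂ)‖ := norm_sub_le _ _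
    _ = |(m j : ℝ)| + i := by simp
    _ ≤ (1 + γ j) * wt m := by nlinarith [abs_nonneg (m j : ℝ)]

/-- Falling factorials of order at most `M` control the `M`-th power of the weight. -/
theorem wt_pow_le_mfall (n M : ℕ) : ∃ C : ℝ, 0 < C ∧ ∀ m : Fin n → ℤ,
    ∃ γ : Fin n → ℕ, mlen γ ≤ M ∧ wt m ^ M ≤ C * ‖mfall γ m‖ := by
  refine ⟨(1 + n * (2 * M + 1)) ^ M + (2 * (1 + n)) ^ M, by positivity, fun m => ?_⟩
  by_cases h : ∀ j, (m j).natAbs ≤ 2 * M + 1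
  · refine ⟨0, by simp, ?_⟩
    rw [mfall_zero, norm_one, mul_one]
    have hl : lone m ≤ n * (2 * M + 1) :=
      (Finset.sum_le_card_nsmul _ _ _ fun j _ => h j).trans (by simp)
    have : wt m ≤ 1 + n * (2 * M + 1) :=
      (wt_le_one_add_lone m).trans (by gcongr; exact_mod_cast hl)
    have h0 := wt_pos m
    calc wt m ^ M ≤ (1 + n * (2 * M + 1)) ^ M := by gcongr
      _ ≤ _ := le_add_of_nonneg_right (by positivity)
  · push Not at h
    obtain ⟨j₀, hj₀⟩ := h
    -- a coordinate of maximal absolute value carries the whole weight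
    obtain ⟨j, -, hj⟩ := Finset.exists_max_image Finset.univ (fun j => (m j).natAbs)
      ⟨j₀, Finset.mem_univ _⟩
    have hjM : 2 * M + 1 < (m j).natAbs := hj₀.trans_le (hj j₀ (Finset.mem_univ _))
    refine ⟨Pi.single j M, by simp, ?_⟩
    have hl : lone m ≤ n * (m j).natAbs :=
      (Finset.sum_le_card_nsmul _ _ _ fun i hi => hj i hi).trans (by simp)
    have hA : (2 * M + 1 : ℝ) < |(m j : ℝ)| := by
      rw [← Int.cast_abs, ← Nat.cast_natAbs]; exact_mod_cast hjM
    have hw : wt m ≤ (1 + n) * |(m j : ℝ)| := by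
      have h2 : (lone m : ℝ) ≤ n * |(m j : ℝ)| := by
        rw [← Int.cast_abs, ← Nat.cast_natAbs]; exact_mod_cast hl
      have := wt_le_one_add_lone m
      nlinarith [(Nat.cast_nonneg M : (0 : ℝ) ≤ M)]
    have hf : ‖mfall (Pi.single j M) m‖ = ∏ i ∈ Finset.range M, ‖((m j : ℂ) - i)‖ := by
      rw [mfall, Finset.prod_eq_single j]
      · simp [fall]
      · intro i _ hi; simp [fall, hi]
      · simp
    have hlow : (wt m / (2 * (1 + n))) ^ M ≤ ‖mfall (Pi.single j M) m‖ := by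
      rw [hf]
      conv_lhs => rw [← Finset.card_range M, ← Finset.prod_const]
      have h0 := wt_pos m
      gcongr with i hi
      have hi' : (i : ℝ) ≤ M := by exact_mod_cast (Finset.mem_range.mp hi).le
      calc wt m / (2 * (1 + n)) ≤ |(m j : ℝ)| / 2 := by
            rw [div_le_div_iff₀ (by positivity) (by norm_num)]; nlinarith
        _ ≤ |(m j : ℝ)| - i := by linarith
        _ = ‖(m j : ℂ)‖ - ‖(i : ℂ)‖ := by simp
        _ ≤ _ := norm_sub_norm_le _ _
    rw [div_pow, div_le_iff₀ (by positivity)] at hlow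
    calc wt m ^ M ≤ (2 * (1 + n)) ^ M * ‖mfall (Pi.single j M) m‖ := by linarith
      _ ≤ _ := by gcongr; exact le_add_of_nonneg_left (by positivity)

theorem fall_mul_fall (a b : ℕ) : ∃ κ : ℕ → ℂ, ∀ x : ℤ,
    fall a x * fall b x = ∑ c ∈ Finset.range (a + b + 1), κ c * fall c x := by
  induction b with
  | zero =>
    refine ⟨fun c => if c = a then 1 else 0, fun x => ?_⟩
    simp [fall, Finset.sum_ite_eq']
  | succ b ih =>
    obtain ⟨κ, h⟩ := ih
    refine ⟨fun c => (if c = 0 then 0 else κ (c - 1)) +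
      (if c < a + b + 1 then κ c * (c - b) else 0), fun x => ?_⟩
    rw [fall_succ, ← mul_assoc, h, Finset.sum_mul]
    simp only [add_mul, Finset.sum_add_distrib]
    have h1 : ∑ c ∈ Finset.range (a + (b + 1) + 1), (if c = 0 then 0 else κ (c - 1)) * fall c x =
        ∑ c ∈ Finset.range (a + b + 1), κ c * fall (c + 1) x := by
      rw [show a + (b + 1) + 1 = (a + b + 1) + 1 by ring, Finset.sum_range_succ']
      simp
    have h2 : ∑ c ∈ Finset.range (a + (b + 1) + 1),
        (if c < a + b + 1 then κ c * (c - b) else 0) * fall c x =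
        ∑ c ∈ Finset.range (a + b + 1), (if c < a + b + 1 then κ c * (c - b) else 0) * fall c x := by
      rw [show a + (b + 1) + 1 = (a + b + 1) + 1 by ring, Finset.sum_range_succ]
      simp
    rw [h1, h2, ← Finset.sum_add_distrib]
    refine Finset.sum_congr rfl fun c hc => ?_
    rw [if_pos (Finset.mem_range.mp hc), fall_succ]
    ring

/-- A product of two multivariate falling factorials is a combination of falling factorials whose
order does not exceed the sum of the orders. -/
theorem mfall_mul_mfall (α β : Fin n → ℕ) :
    ∃ (s : Finset (Fin n → ℕ)) (κ : (Fin n → ℕ) → ℂ), (∀ γ ∈ s, mlen γ ≤ mlen α + mlen β) ∧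
      ∀ m : Fin n → ℤ, mfall α m * mfall β m = ∑ γ ∈ s, κ γ * mfall γ m := by
  choose κ hκ using fall_mul_fall
  refine ⟨Fintype.piFinset fun j => Finset.range (α j + β j + 1),
    fun γ => ∏ j, κ (α j) (β j) (γ j), fun γ hγ => ?_, fun m => ?_⟩
  · rw [← mlen_add]
    refine Finset.sum_le_sum fun j _ => ?_
    have := Fintype.mem_piFinset.mp hγ j
    simp only [Finset.mem_range] at this
    simp only [Pi.add_apply]
    omega
  · simp only [mfall, ← Finset.prod_mul_distrib, hκ]
    exact Finset.prod_univ_sum _ _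

/-! ### Newton expansion on the lattice -/

theorem mfact_ne_zero (α : Fin n → ℕ) : (mfact α : ℂ) ≠ 0 := by
  simp [mfact, Finset.prod_ne_zero_iff, Nat.factorial_ne_zero]

/-- Pascal's rule for the multivariate binomial coefficients `m^{(α)} / α!`. -/
theorem dif_mfall_div (α : Fin n → ℕ) (j : Fin n) (m : Fin n → ℤ) :
    mfall (α + Pi.single j 1) (m + Pi.single j 1) / mfact (α + Pi.single j 1) -
      mfall (α + Pi.single j 1) m / mfact (α + Pi.single j 1) = mfall α m / mfact α := by
  have hm : ∀ m : Fin n → ℤ, mfall (α + Pi.single j 1) m =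
      fall (α j + 1) (m j) * ∏ i ∈ Finset.univ.erase j, fall (α i) (m i) := by
    intro m
    rw [mfall, ← Finset.mul_prod_erase _ _ (Finset.mem_univ j)]
    congr 1
    · simp
    · exact Finset.prod_congr rfl fun i hi => by simp [Finset.ne_of_mem_erase hi]
  have hf : mfact (α + Pi.single j 1) = (α j + 1) * mfact α := by
    rw [mfact, mfact, ← Finset.mul_prod_erase _ _ (Finset.mem_univ j),
      ← Finset.mul_prod_erase Finset.univ (fun i => (α i).factorial) (Finset.mem_univ j),
      ← mul_assoc, ← Nat.factorial_succ]
    congr 1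
    · simp
    · exact Finset.prod_congr rfl fun i hi => by simp [Finset.ne_of_mem_erase hi]
  have hm' : ∏ i ∈ Finset.univ.erase j, fall (α i) ((m + Pi.single j 1 : Fin n → ℤ) i) =
      ∏ i ∈ Finset.univ.erase j, fall (α i) (m i) :=
    Finset.prod_congr rfl fun i hi => by simp [Finset.ne_of_mem_erase hi]
  have hm0 : mfall α m = fall (α j) (m j) * ∏ i ∈ Finset.univ.erase j, fall (α i) (m i) := by
    rw [mfall, ← Finset.mul_prod_erase _ _ (Finset.mem_univ j)]
  have h1 : ((α j : ℂ) + 1) ≠ 0 := by exact_mod_cast Nat.succ_ne_zero (α j)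
  rw [hm, hm, hm', hf, hm0]
  rw [show (m + Pi.single j 1 : Fin n → ℤ) j = m j + 1 by simp, fall_succ_add_one, fall_succ]
  have h2 := mfact_ne_zero α
  push_cast
  field_simp
  ring

theorem mfall_add_single_of_eq_zero (α : Fin n → ℕ) (j : Fin n) (h : α j = 0) (m : Fin n → ℤ) :
    mfall α (m + Pi.single j 1) = mfall α m := by
  refine Finset.prod_congr rfl fun i _ => ?_
  rcases eq_or_ne i j with rfl | hi
  · simp [h, fall]
  · simp [hi]

theorem mfall_at_zero (α : Fin n → ℕ) (h : α ≠ 0) : mfall α 0 = 0 := by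
  obtain ⟨j, hj⟩ := Function.ne_iff.mp h
  refine Finset.prod_eq_zero (Finset.mem_univ j) ?_
  exact Finset.prod_eq_zero (Finset.mem_range.mpr (Nat.pos_of_ne_zero hj)) (by simp)

/-- The remainder after the terms of order less than `N` in the Newton expansion of
`m ↦ τ (k + m)` at `m = 0`. -/
noncomputable def newtonRem (N : ℕ) (τ : (Fin n → ℤ) → ℂ) (k m : Fin n → ℤ) : ℂ :=
  τ (k + m) - ∑ α ∈ multiLT n N, mfall α m / mfact α * diff α τ k

theorem newtonRem_at_zero (N : ℕ) (τ : (Fin n → ℤ) → ℂ) (k : Fin n → ℤ) :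
    newtonRem (N + 1) τ k 0 = 0 := by
  rw [newtonRem, Finset.sum_eq_single 0]
  · simp [mfact]
  · intro α _ hα; simp [mfall_at_zero α hα]
  · intro h; exact absurd ((mem_multiLT _).mpr (by simp)) h

/-- Differencing the Newton remainder in the increment lowers its order. -/
theorem dif_newtonRem (N : ℕ) (τ : (Fin n → ℤ) → ℂ) (k m : Fin n → ℤ) (j : Fin n) :
    newtonRem (N + 1) τ k (m + Pi.single j 1) - newtonRem (N + 1) τ k m =
      newtonRem N (dif j τ) k m := by
  have h : ∑ α ∈ multiLT n N, mfall α m / mfact α * diff α (dif j τ) k =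
      ∑ α ∈ multiLT n (N + 1), (mfall α (m + Pi.single j 1) / mfact α * diff α τ k -
        mfall α m / mfact α * diff α τ k) := by
    refine Finset.sum_of_injOn (fun α => α + Pi.single j 1) (fun _ _ _ _ h => by simpa using h)
      ?_ ?_ ?_
    · intro α hα
      simp only [Finset.mem_coe, mem_multiLT] at hα ⊢
      simpa using hα
    · intro α hα hα'
      have : α j = 0 := by
        by_contra hj
        apply hα'
        have e : (α - Pi.single j 1) + Pi.single j 1 = α := by
          funext i
          rcases eq_or_ne i j with rfl | hi
          · simp only [Pi.add_apply, Pi.sub_apply, Pi.single_eq_same]; omega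
          · simp [hi]
        refine ⟨α - Pi.single j 1, ?_, e⟩
        rw [← e, mem_multiLT] at hα
        simpa [mem_multiLT] using hα
      rw [mfall_add_single_of_eq_zero α j this, sub_self]
    · intro α _
      rw [← sub_mul, dif_mfall_div, diff_dif, diff_add_single]
  simp only [newtonRem, h, Finset.sum_sub_distrib, dif, fwdDiff, add_assoc]
  ring

/-- The Newton remainder of order `N` is bounded on the `ℓ¹` ball of radius `r` by `r ^ N` times
a bound for the differences of order `N` on that ball. -/
theorem norm_newtonRem_le (N : ℕ) (τ : (Fin n → ℤ) → ℂ) (k : Fin n → ℤ) (r : ℕ) (B : ℝ)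
    (hB0 : 0 ≤ B) (hB : ∀ α, mlen α = N → ∀ p, lone p ≤ r → ‖diff α τ (k + p)‖ ≤ B)
    (m : Fin n → ℤ) (hm : lone m ≤ r) : ‖newtonRem N τ k m‖ ≤ (r : ℝ) ^ N * B := by
  induction N generalizing τ m with
  | zero =>
    have := hB 0 (by simp) m hm
    have h0 : multiLT n 0 = ∅ := by ext α; simp [mem_multiLT]
    simpa [newtonRem, h0] using this
  | succ N ih =>
    have ih' : ∀ j m, lone m ≤ r → ‖newtonRem N (dif j τ) k m‖ ≤ (r : ℝ) ^ N * B := by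
      intro j m hm
      refine ih (dif j τ) (fun α hα p hp => ?_) m hm
      rw [diff_dif, ← diff_add_single]
      exact hB _ (by simp [hα]) p hp
    have hB0' : 0 ≤ (r : ℝ) ^ N * B := by positivity
    -- walk from the origin to `m` by unit steps inside the `ℓ¹` ball
    have walk : ∀ s m, lone m = s → s ≤ r →
        ‖newtonRem (N + 1) τ k m‖ ≤ s * ((r : ℝ) ^ N * B) := by
      intro s
      induction s with
      | zero =>
        intro m hm _
        have : m = 0 := by
          funext j
          have h0 := Finset.sum_eq_zero_iff.mp hm j (Finset.mem_univ j)
          simpa using h0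
        simp [this, newtonRem_at_zero]
      | succ s ihs =>
        intro m hm hs
        obtain ⟨j, hj⟩ : ∃ j, m j ≠ 0 := by
          by_contra! hc
          simp [lone, hc] at hm
        have key : ∀ m' : Fin n → ℤ, (∀ i, i ≠ j → m' i = m i) →
            (m' j).natAbs + 1 = (m j).natAbs → lone m' = s := by
          intro m' h1 h2
          rw [lone, ← Finset.add_sum_erase _ _ (Finset.mem_univ j)] at hm ⊢
          rw [Finset.sum_congr rfl fun i hi => by rw [h1 i (Finset.ne_of_mem_erase hi)]]
          omega
        push_cast
        rcases lt_or_gt_of_ne hj with hneg | hpos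
        · have hm' : lone (m + Pi.single j 1) = s := by
            refine key _ (fun i hi => by simp [hi]) ?_
            simp only [Pi.add_apply, Pi.single_eq_same]; omega
          have h1 := ihs _ hm' (by omega)
          have h2 := ih' j m (by omega)
          have h3 := dif_newtonRem N τ k m j
          have : newtonRem (N + 1) τ k m = newtonRem (N + 1) τ k (m + Pi.single j 1) -
            newtonRem N (dif j τ) k m := by rw [← h3]; ring
          rw [this]
          refine (norm_sub_le _ _).trans ?_
          linarith
        · have hm' : lone (m - Pi.single j 1) = s := by
            refine key _ (fun i hi => by simp [hi]) ?_
            simp only [Pi.sub_apply, Pi.single_eq_same]; omega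
          have h1 := ihs _ hm' (by omega)
          have h2 := ih' j (m - Pi.single j 1) (by omega)
          have h3 := dif_newtonRem N τ k (m - Pi.single j 1) j
          rw [sub_add_cancel] at h3
          have : newtonRem (N + 1) τ k m = newtonRem (N + 1) τ k (m - Pi.single j 1) +
            newtonRem N (dif j τ) k (m - Pi.single j 1) := by rw [← h3]; ring
          rw [this]
          refine (norm_add_le _ _).trans ?_
          linarith
    refine (walk _ m rfl hm).trans ?_
    rw [pow_succ', mul_assoc]
    gcongr

open MeasureTheory UnitAddTorus

/-! ### Smooth functions on the torus -/

/-- The quotient map `ℝⁿ → 𝕋ⁿ`. -/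
def proj (y : Fin n → ℝ) : UnitAddTorus (Fin n) := fun j => (y j : UnitAddCircle)

theorem isOpenQuotientMap_proj : IsOpenQuotientMap (proj (n := n)) :=
  IsOpenQuotientMap.piMap fun _ => QuotientAddGroup.isOpenQuotientMap_mk

theorem proj_surjective : Function.Surjective (proj (n := n)) := isOpenQuotientMap_proj.surjective

theorem proj_add_single (y : Fin n → ℝ) (j : Fin n) (t : ℝ) :
    proj y + Pi.single j (t : UnitAddCircle) = proj (y + t • Pi.single j 1) := by
  funext i
  rcases eq_or_ne i j with rfl | hi
  · simp [proj]
  · simp [proj, hi]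

theorem SmoothTorus.comp_proj {f : UnitAddTorus (Fin n) → ℂ} (hf : SmoothTorus f) :
    ContDiff ℝ ∞ (f ∘ proj) := hf

theorem SmoothTorus.continuous {f : UnitAddTorus (Fin n) → ℂ} (hf : SmoothTorus f) :
    Continuous f :=
  isOpenQuotientMap_proj.isQuotientMap.continuous_iff.mpr (ContDiff.continuous hf)

theorem SmoothTorus.add {f g : UnitAddTorus (Fin n) → ℂ} (hf : SmoothTorus f)
    (hg : SmoothTorus g) : SmoothTorus fun x => f x + g x := ContDiff.add hf hg

theorem SmoothTorus.sub {f g : UnitAddTorus (Fin n) → ℂ} (hf : SmoothTorus f)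
    (hg : SmoothTorus g) : SmoothTorus fun x => f x - g x := ContDiff.sub hf hg

theorem SmoothTorus.const_mul {f : UnitAddTorus (Fin n) → ℂ} (c : ℂ) (hf : SmoothTorus f) :
    SmoothTorus fun x => c * f x := ContDiff.mul contDiff_const hf

theorem SmoothTorus.sum {ι : Type*} (s : Finset ι) {f : ι → UnitAddTorus (Fin n) → ℂ}
    (hf : ∀ i ∈ s, SmoothTorus (f i)) : SmoothTorus fun x => ∑ i ∈ s, f i x :=
  ContDiff.sum hf

theorem SmoothTorus.diff {F : (Fin n → ℤ) → UnitAddTorus (Fin n) → ℂ}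
    (hF : ∀ k, SmoothTorus (F k)) (α : Fin n → ℕ) (k : Fin n → ℤ) :
    SmoothTorus fun x => PsiDO.diff α (fun k' => F k' x) k := by
  obtain ⟨ι, _, w, v, h⟩ := diff_eq_sum_shift α
  simp only [h]
  exact SmoothTorus.sum _ fun i _ => (hF _).const_mul _

theorem pd_proj {f : UnitAddTorus (Fin n) → ℂ} (hf : SmoothTorus f) (j : Fin n)
    (y : Fin n → ℝ) : pd j f (proj y) =
      (2 * Real.pi * Complex.I)⁻¹ * fderiv ℝ (f ∘ proj) y (Pi.single j 1) := by
  rw [pd]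
  congr 1
  have h1 : HasFDerivAt (f ∘ proj) (fderiv ℝ (f ∘ proj) y) (y + (0 : ℝ) • Pi.single j (1 : ℝ)) := by
    rw [zero_smul, add_zero]
    exact ((hf.comp_proj.differentiable (by simp)) y).hasFDerivAt
  have h2 : HasDerivAt (fun t : ℝ => y + t • Pi.single j (1 : ℝ)) (Pi.single j 1) 0 := by
    simpa using ((hasDerivAt_id (0 : ℝ)).smul_const (Pi.single j (1 : ℝ) : Fin n → ℝ)).const_add y
  have := h1.comp_hasDerivAt (0 : ℝ) h2
  simp only [proj_add_single]
  exact this.deriv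

theorem SmoothTorus.pd {f : UnitAddTorus (Fin n) → ℂ} (hf : SmoothTorus f) (j : Fin n) :
    SmoothTorus (PsiDO.pd j f) := by
  have h : ContDiff ℝ ∞ fun y => (2 * Real.pi * Complex.I)⁻¹ *
      fderiv ℝ (f ∘ proj) y (Pi.single j 1) :=
    contDiff_const.mul ((hf.comp_proj.fderiv_right (by simp)).clm_apply contDiff_const)
  have e : (fun y => (2 * Real.pi * Complex.I)⁻¹ * fderiv ℝ (f ∘ proj) y (Pi.single j 1)) =
    fun y => PsiDO.pd j f (proj y) := funext fun y => (pd_proj hf j y).symm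
  rw [e] at h
  exact h

theorem SmoothTorus.pdFall {f : UnitAddTorus (Fin n) → ℂ} (hf : SmoothTorus f) (j : Fin n)
    (a : ℕ) : SmoothTorus (PsiDO.pdFall j a f) := by
  induction a with
  | zero => exact hf
  | succ a ih => exact (ih.pd j).sub (ih.const_mul _)

theorem SmoothTorus.mpd {f : UnitAddTorus (Fin n) → ℂ} (hf : SmoothTorus f) (α : Fin n → ℕ) :
    SmoothTorus (PsiDO.mpd α f) := by
  unfold PsiDO.mpd
  induction List.finRange n with
  | nil => exact hf
  | cons i L ih => exact ih.pdFall i _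

theorem hasDerivAt_add_single {f : UnitAddTorus (Fin n) → ℂ} (hf : SmoothTorus f) (j : Fin n)
    (x : UnitAddTorus (Fin n)) (t : ℝ) :
    HasDerivAt (fun t : ℝ => f (x + Pi.single j (t : UnitAddCircle)))
      (2 * Real.pi * Complex.I * pd j f (x + Pi.single j (t : UnitAddCircle))) t := by
  obtain ⟨y, rfl⟩ := proj_surjective x
  have h1 := ((hf.comp_proj.differentiable (by simp)) (y + t • Pi.single j (1 : ℝ))).hasFDerivAt
  have h2 : HasDerivAt (fun t : ℝ => y + t • Pi.single j (1 : ℝ)) (Pi.single j 1) t := by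
    simpa using ((hasDerivAt_id t).smul_const (Pi.single j (1 : ℝ) : Fin n → ℝ)).const_add y
  have := h1.comp_hasDerivAt t h2
  simp only [proj_add_single]
  rw [pd_proj hf, mul_inv_cancel_left₀ Complex.two_pi_I_ne_zero]
  exact this

/-! ### Fourier coefficients -/

instance : IsProbabilityMeasure (torusMeasure n) := by
  unfold torusMeasure; infer_instance

instance : (torusMeasure n).IsAddHaarMeasure := by
  unfold torusMeasure; infer_instance

theorem integrable_of_continuous {f : UnitAddTorus (Fin n) → ℂ} (hf : Continuous f) :
    Integrable f (torusMeasure n) := by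
  rw [← integrableOn_univ]
  exact hf.continuousOn.integrableOn_compact isCompact_univ

theorem norm_mFourier_apply (m : Fin n → ℤ) (x : UnitAddTorus (Fin n)) : ‖mFourier m x‖ = 1 := by
  simp only [mFourier, fourier_apply, ContinuousMap.coe_mk, norm_prod, Circle.norm_coe,
    Finset.prod_const_one]

theorem mFourier_apply_add (m : Fin n → ℤ) (x y : UnitAddTorus (Fin n)) :
    mFourier m (x + y) = mFourier m x * mFourier m y := by
  simp [mFourier, fourier_apply, AddCircle.toCircle_add, Finset.prod_mul_distrib, smul_add]

theorem mFourier_apply_single (m : Fin n → ℤ) (j : Fin n) (t : ℝ) :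
    mFourier m (Pi.single j (t : UnitAddCircle)) =
      Complex.exp (2 * Real.pi * Complex.I * m j * t) := by
  rw [mFourier, ContinuousMap.coe_mk, Finset.prod_eq_single j]
  · rw [Pi.single_eq_same, fourier_coe_apply]; simp
  · intro i _ hi; rw [Pi.single_eq_of_ne hi]; simp [fourier_apply]
  · simp

/-- The Fourier coefficient `∫ e^{-2πi m·x} f(x) dx`. It is definitionally Mathlib's
`UnitAddTorus.mFourierCoeff`, with the measure spelled as `torusMeasure n`. -/
noncomputable def coef (f : UnitAddTorus (Fin n) → ℂ) (m : Fin n → ℤ) : ℂ :=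
  ∫ x, mFourier (-m) x * f x ∂(torusMeasure n)

theorem integrable_mFourier_mul {f : UnitAddTorus (Fin n) → ℂ} (hf : Continuous f)
    (m : Fin n → ℤ) : Integrable (fun x => mFourier m x * f x) (torusMeasure n) :=
  integrable_of_continuous (by fun_prop)

theorem coef_add {f g : UnitAddTorus (Fin n) → ℂ} (hf : Continuous f) (hg : Continuous g)
    (m : Fin n → ℤ) : coef (fun x => f x + g x) m = coef f m + coef g m := by
  simp only [coef, mul_add]
  exact integral_add (integrable_mFourier_mul hf _) (integrable_mFourier_mul hg _)

theorem coef_sub {f g : UnitAddTorus (Fin n) → ℂ} (hf : Continuous f) (hg : Continuous g)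
    (m : Fin n → ℤ) : coef (fun x => f x - g x) m = coef f m - coef g m := by
  simp only [coef, mul_sub]
  exact integral_sub (integrable_mFourier_mul hf _) (integrable_mFourier_mul hg _)

theorem coef_const_mul (c : ℂ) (f : UnitAddTorus (Fin n) → ℂ) (m : Fin n → ℤ) :
    coef (fun x => c * f x) m = c * coef f m := by
  simp only [coef, mul_left_comm _ c]
  exact integral_const_mul _ _

theorem coef_sum {ι : Type*} (s : Finset ι) {f : ι → UnitAddTorus (Fin n) → ℂ}
    (hf : ∀ i ∈ s, Continuous (f i)) (m : Fin n → ℤ) :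
    coef (fun x => ∑ i ∈ s, f i x) m = ∑ i ∈ s, coef (f i) m := by
  simp only [coef, Finset.mul_sum]
  exact integral_finsetSum _ fun i hi => integrable_mFourier_mul (hf i hi) _

theorem coef_diff {F : (Fin n → ℤ) → UnitAddTorus (Fin n) → ℂ}
    (hF : ∀ k, Continuous (F k)) (α : Fin n → ℕ) (k m : Fin n → ℤ) :
    coef (fun x => diff α (fun k' => F k' x) k) m = diff α (fun k' => coef (F k') m) k := by
  obtain ⟨ι, _, w, v, h⟩ := diff_eq_sum_shift α
  simp only [h]
  rw [coef_sum (f := fun i x => w i * F (k + v i) x) _ fun i _ => continuous_const.mul (hF _)]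
  simp only [coef_const_mul]

theorem norm_coef_le {f : UnitAddTorus (Fin n) → ℂ} {B : ℝ} (hB : ∀ x, ‖f x‖ ≤ B)
    (m : Fin n → ℤ) : ‖coef f m‖ ≤ B := by
  refine (norm_integral_le_of_norm_le_const (C := B) (Filter.Eventually.of_forall fun x => ?_)).trans
    (by simp)
  rw [norm_mul, norm_mFourier_apply, one_mul]
  exact hB x

/-- Translating `f` in the direction `e_j` multiplies its Fourier coefficients by a character. -/
theorem coef_translate (f : UnitAddTorus (Fin n) → ℂ) (j : Fin n) (t : ℝ) (m : Fin n → ℤ) :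
    coef (fun x => f (x + Pi.single j (t : UnitAddCircle))) m =
      Complex.exp (2 * Real.pi * Complex.I * m j * t) * coef f m := by
  have h := integral_add_right_eq_self (μ := torusMeasure n)
    (fun x => mFourier (-m) (x - Pi.single j (t : UnitAddCircle)) * f x)
    (Pi.single j (t : UnitAddCircle))
  simp only [add_sub_cancel_right] at h
  rw [coef, h, coef, ← integral_const_mul]
  congr 1
  funext x
  rw [sub_eq_add_neg, mFourier_apply_add, ← Pi.single_neg, ← AddCircle.coe_neg,
    mFourier_apply_single]
  simp only [Pi.neg_apply, Int.cast_neg, Complex.ofReal_neg]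
  rw [show 2 * (Real.pi : ℂ) * Complex.I * -(m j : ℂ) * -(t : ℂ) =
    2 * Real.pi * Complex.I * m j * t by ring]
  ring

theorem hasDerivAt_integral_of_bounded {X : Type*} [MeasurableSpace X] {μ : Measure X}
    [IsFiniteMeasure μ] {F F' : ℝ → X → ℂ} {B : ℝ} (hF : ∀ t, Integrable (F t) μ)
    (hF' : Integrable (F' 0) μ) (hbd : ∀ x t, ‖F' t x‖ ≤ B)
    (hder : ∀ x t, HasDerivAt (fun t => F t x) (F' t x) t) :
    HasDerivAt (fun t => ∫ x, F t x ∂μ) (∫ x, F' 0 x ∂μ) 0 :=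
  (hasDerivAt_integral_of_dominated_loc_of_deriv_le (s := Set.univ) (bound := fun _ => B)
    Filter.univ_mem (Filter.Eventually.of_forall fun t => (hF t).aestronglyMeasurable) (hF 0)
    hF'.aestronglyMeasurable (Filter.Eventually.of_forall fun x t _ => hbd x t)
    (integrable_const _) (Filter.Eventually.of_forall fun x t _ => hder x t)).2

/-- `D_{x_j}` multiplies the `m`-th Fourier coefficient by `m_j`, by differentiating the
translation rule `coef_translate` under the integral sign. -/
theorem coef_pd {f : UnitAddTorus (Fin n) → ℂ} (hf : SmoothTorus f) (j : Fin n)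
    (m : Fin n → ℤ) : coef (pd j f) m = m j * coef f m := by
  obtain ⟨B, hB⟩ := isCompact_univ.exists_bound_of_continuousOn (hf.pd j).continuous.continuousOn
  have hc : ∀ (g : UnitAddTorus (Fin n) → ℂ), Continuous g → ∀ t : ℝ,
      Continuous fun x : UnitAddTorus (Fin n) => g (x + Pi.single j (t : UnitAddCircle)) := by
      intro g hg t
      have : Continuous fun x : UnitAddTorus (Fin n) => x + Pi.single j (t : UnitAddCircle) := by
        fun_prop
      exact hg.comp this
  let F : ℝ → UnitAddTorus (Fin n) → ℂ :=
    fun t x => mFourier (-m) x * f (x + Pi.single j (t : UnitAddCircle))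
  let F' : ℝ → UnitAddTorus (Fin n) → ℂ := fun t x => mFourier (-m) x *
    (2 * Real.pi * Complex.I * pd j f (x + Pi.single j (t : UnitAddCircle)))
  have hF : ∀ t : ℝ, Integrable (F t) (torusMeasure n) :=
    fun t => integrable_mFourier_mul (hc f hf.continuous t) _
  have hF' : Integrable (F' 0) (torusMeasure n) :=
    integrable_mFourier_mul (continuous_const.mul (hc _ (hf.pd j).continuous 0)) _
  have hbd : ∀ x t, ‖F' t x‖ ≤ 2 * Real.pi * B := by
    intro x t
    have h2 : ‖(2 * Real.pi * Complex.I : ℂ)‖ = 2 * Real.pi := by simp [abs_of_pos Real.pi_pos]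
    rw [norm_mul, norm_mFourier_apply, norm_mul, one_mul, h2]
    gcongr
    exact hB _ (Set.mem_univ _)
  have hder : ∀ x t, HasDerivAt (fun t => F t x) (F' t x) t :=
    fun x t => (hasDerivAt_add_single hf j x t).const_mul _
  have h1 := hasDerivAt_integral_of_bounded hF hF' hbd hder
  have h2 : (fun t : ℝ => ∫ x, F t x ∂(torusMeasure n)) = fun t : ℝ => Complex.exp (2 * Real.pi * Complex.I * m j * t) * coef f m :=
    funext fun t => coef_translate f j t m
  have h3 : HasDerivAt (fun t : ℝ => Complex.exp (2 * Real.pi * Complex.I * m j * t) * coef f m)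
      (2 * Real.pi * Complex.I * m j * coef f m) 0 := by
    have := (((hasDerivAt_id (0 : ℝ)).ofReal_comp.const_mul
      (2 * Real.pi * Complex.I * m j)).cexp).mul_const (coef f m)
    simpa using this
  rw [h2] at h1
  have h4 := h1.unique h3
  have h5 : F' 0 = fun x => 2 * Real.pi * Complex.I * (mFourier (-m) x * pd j f x) := by
    funext x
    simp only [F', AddCircle.coe_zero, Pi.single_zero, add_zero]
    ring
  rw [h5, integral_const_mul, mul_assoc (2 * Real.pi * Complex.I : ℂ) (m j : ℂ)] at h4
  exact mul_left_cancel₀ Complex.two_pi_I_ne_zero h4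

theorem coef_pdFall {f : UnitAddTorus (Fin n) → ℂ} (hf : SmoothTorus f) (j : Fin n) (a : ℕ)
    (m : Fin n → ℤ) : coef (pdFall j a f) m = fall a (m j) * coef f m := by
  induction a with
  | zero => simp [pdFall, fall]
  | succ a ih =>
    have hs := hf.pdFall j a
    simp only [pdFall]
    rw [coef_sub (hs.pd j).continuous (hs.const_mul _).continuous, coef_pd hs, coef_const_mul, ih,
      fall_succ]
    ring

theorem coef_mpd {f : UnitAddTorus (Fin n) → ℂ} (hf : SmoothTorus f) (α : Fin n → ℕ)
    (m : Fin n → ℤ) : coef (mpd α f) m = mfall α m * coef f m := by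
  have key : ∀ L : List (Fin n),
      SmoothTorus (L.foldr (fun j g => pdFall j (α j) g) f) ∧
      coef (L.foldr (fun j g => pdFall j (α j) g) f) m =
        (L.map fun j => fall (α j) (m j)).prod * coef f m := by
    intro L
    induction L with
    | nil => exact ⟨hf, by simp⟩
    | cons i L ih =>
      refine ⟨ih.1.pdFall i _, ?_⟩
      rw [List.foldr_cons, coef_pdFall ih.1, ih.2]
      simp [mul_assoc]
  rw [mpd, (key _).2, mfall, Fin.prod_univ_def]

/-- Decay of Fourier coefficients: bounds for the derivatives of order at most `M` give a bound
by the `M`-th negative power of the weight, with a constant that does not depend on the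
function. -/
theorem norm_coef_le_of_mpd (n M : ℕ) : ∃ C : ℝ, 0 < C ∧
    ∀ (f : UnitAddTorus (Fin n) → ℂ), SmoothTorus f → ∀ B : ℝ,
      (∀ γ, mlen γ ≤ M → ∀ x, ‖mpd γ f x‖ ≤ B) →
      ∀ m : Fin n → ℤ, ‖coef f m‖ * wt m ^ M ≤ C * B := by
  obtain ⟨C, hC, h⟩ := wt_pow_le_mfall n M
  refine ⟨C, hC, fun f hf B hB m => ?_⟩
  obtain ⟨γ, hγ, hm⟩ := h m
  have h1 := norm_coef_le (hB γ hγ) m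
  rw [coef_mpd hf, norm_mul] at h1
  calc ‖coef f m‖ * wt m ^ M ≤ ‖coef f m‖ * (C * ‖mfall γ m‖) := by gcongr
    _ = C * (‖mfall γ m‖ * ‖coef f m‖) := by ring
    _ ≤ C * B := by gcongr

theorem SmoothTorus.coef_decay {f : UnitAddTorus (Fin n) → ℂ} (hf : SmoothTorus f) (M : ℕ) :
    ∃ C : ℝ, ∀ m : Fin n → ℤ, ‖coef f m‖ * wt m ^ M ≤ C := by
  obtain ⟨C, hC, h⟩ := norm_coef_le_of_mpd n M
  have hb : ∀ γ, ∃ B, ∀ x, ‖PsiDO.mpd γ f x‖ ≤ B := fun γ => by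
    obtain ⟨B, hB⟩ := isCompact_univ.exists_bound_of_continuousOn
      (hf.mpd γ).continuous.continuousOn
    exact ⟨B, fun x => hB x (Set.mem_univ x)⟩
  choose B hB using hb
  refine ⟨C * ∑ γ ∈ multiLT n (M + 1), B γ, h f hf _ fun γ hγ x => (hB γ x).trans ?_⟩
  exact Finset.single_le_sum (fun γ _ => (norm_nonneg _).trans (hB γ 0))
    ((mem_multiLT γ).mpr (Nat.lt_succ_of_le hγ))

theorem summable_of_wt_decay {s : (Fin n → ℤ) → ℂ} {C : ℝ}
    (h : ∀ m, ‖s m‖ * wt m ^ (2 * n) ≤ C) : Summable fun m => ‖s m‖ := by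
  refine ((summable_wt n).mul_left C).of_nonneg_of_le (fun m => norm_nonneg _) fun m => ?_
  rw [← div_eq_mul_inv, le_div_iff₀ (pow_pos (wt_pos m) _)]
  exact h m

theorem SmoothTorus.summable_coef {f : UnitAddTorus (Fin n) → ℂ} (hf : SmoothTorus f) :
    Summable fun m => ‖coef f m‖ :=
  summable_of_wt_decay (hf.coef_decay (2 * n)).choose_spec

theorem SmoothTorus.hasSum_coef {f : UnitAddTorus (Fin n) → ℂ} (hf : SmoothTorus f)
    (x : UnitAddTorus (Fin n)) : HasSum (fun m => coef f m * mFourier m x) (f x) :=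
  hasSum_mFourier_series_apply_of_summable (f := ⟨f, hf.continuous⟩) hf.summable_coef.of_norm x

/-- A smooth function is determined by its Fourier coefficients. This turns identities between
differential operators into identities between falling factorials. -/
theorem SmoothTorus.ext {f g : UnitAddTorus (Fin n) → ℂ} (hf : SmoothTorus f)
    (hg : SmoothTorus g) (h : ∀ m, coef f m = coef g m) : f = g := by
  funext x
  have h1 := hf.hasSum_coef x
  simp only [h] at h1
  exact h1.unique (hg.hasSum_coef x)

theorem SmoothTorus.norm_le_tsum_coef {f : UnitAddTorus (Fin n) → ℂ} (hf : SmoothTorus f)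
    (x : UnitAddTorus (Fin n)) : ‖f x‖ ≤ ∑' m, ‖coef f m‖ := by
  rw [← (hf.hasSum_coef x).tsum_eq]
  refine (norm_tsum_le_tsum_norm ?_).trans (le_of_eq ?_)
  · simpa [norm_mFourier_apply] using hf.summable_coef
  · simp [norm_mFourier_apply]

/-! ### Fourier series with rapidly decreasing coefficients -/

theorem coef_mFourier (m k : Fin n → ℤ) : coef (mFourier k) m = if k = m then 1 else 0 := by
  split_ifs with h
  · subst h
    have : ∀ x : UnitAddTorus (Fin n), mFourier (-k) x * mFourier k x = 1 := fun x => by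
      rw [← mFourier_add, neg_add_cancel, mFourier_zero]; rfl
    simp [coef, this]
  · obtain ⟨j, hj⟩ := Function.ne_iff.mp h
    -- translating by half a period of `x_j ↦ e^{2πi (k_j - m_j) x_j}` changes the sign
    have hz : ((k j : ℂ) - m j) ≠ 0 := sub_ne_zero.mpr (by exact_mod_cast hj)
    let t : ℝ := 1 / (2 * ((k j : ℝ) - m j))
    have h1 := coef_translate (mFourier k) j t m
    simp only [mFourier_apply_add, mFourier_apply_single, mul_comm (mFourier k _)] at h1
    rw [coef_const_mul] at h1
    have h2 : Complex.exp (2 * Real.pi * Complex.I * k j * t) =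
        - Complex.exp (2 * Real.pi * Complex.I * m j * t) := by
      rw [← mul_neg_one, ← Complex.exp_pi_mul_I, ← Complex.exp_add]
      congr 1
      simp only [t]
      push_cast
      field_simp
      ring
    rw [h2, neg_mul, neg_eq_iff_add_eq_zero, ← two_mul, mul_eq_zero, mul_eq_zero] at h1
    simpa [Complex.exp_ne_zero] using h1

theorem iteratedDeriv_cexp_mul_ofReal (c : ℂ) (i : ℕ) :
    iteratedDeriv i (fun t : ℝ => Complex.exp (c * t)) =
      fun t : ℝ => c ^ i * Complex.exp (c * t) := by
  induction i with
  | zero => simp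
  | succ i ih =>
    rw [iteratedDeriv_succ, ih]
    funext t
    have := (((hasDerivAt_id t).ofReal_comp.const_mul c).cexp).const_mul (c ^ i)
    simp only [id_eq, Complex.ofReal_one, mul_one] at this
    rw [this.deriv]
    ring

/-- The linear form `y ↦ m · y`. -/
noncomputable def dotForm (m : Fin n → ℤ) : (Fin n → ℝ) →L[ℝ] ℝ :=
  ∑ j, (m j : ℝ) • ContinuousLinearMap.proj j

theorem norm_dotForm_le (m : Fin n → ℤ) : ‖dotForm m‖ ≤ n * wt m := by
  refine (norm_sum_le _ _).trans ((Finset.sum_le_card_nsmul _ _ (wt m) fun j _ => ?_).trans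
    (by simp))
  rw [norm_smul]
  have h1 : ‖(ContinuousLinearMap.proj j : (Fin n → ℝ) →L[ℝ] ℝ)‖ ≤ 1 :=
    ContinuousLinearMap.opNorm_le_bound _ zero_le_one fun y => by
      rw [one_mul]; exact norm_le_pi_norm y j
  have h2 := one_add_abs_le_wt m j
  rw [Real.norm_eq_abs]
  nlinarith [abs_nonneg (m j : ℝ), norm_nonneg (ContinuousLinearMap.proj j : (Fin n → ℝ) →L[ℝ] ℝ)]

theorem mFourier_proj (m : Fin n → ℤ) (y : Fin n → ℝ) :
    mFourier m (proj y) = Complex.exp (2 * Real.pi * Complex.I * (dotForm m y : ℝ)) := by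
  simp only [mFourier, ContinuousMap.coe_mk, proj, fourier_coe_apply, ← Complex.exp_sum]
  congr 1
  simp [dotForm, Finset.mul_sum, mul_assoc]

theorem contDiff_mFourier_proj (m : Fin n → ℤ) :
    ContDiff ℝ ∞ fun y : Fin n → ℝ => mFourier m (proj y) := by
  simp only [mFourier_proj]
  exact Complex.contDiff_exp.comp (contDiff_const.mul
    (Complex.ofRealCLM.contDiff.comp (dotForm m).contDiff))

theorem norm_iteratedFDeriv_mFourier_le (m : Fin n → ℤ) (i : ℕ) (y : Fin n → ℝ) :
    ‖iteratedFDeriv ℝ i (fun y => mFourier m (proj y)) y‖ ≤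
      (2 * Real.pi * n) ^ i * wt m ^ i := by
  have h0 : ContDiff ℝ ∞ fun t : ℝ => Complex.exp (2 * Real.pi * Complex.I * t) :=
    Complex.contDiff_exp.comp (contDiff_const.mul Complex.ofRealCLM.contDiff)
  have e : (fun y => mFourier m (proj y)) =
      (fun t : ℝ => Complex.exp (2 * Real.pi * Complex.I * t)) ∘ dotForm m :=
    funext fun y => mFourier_proj m y
  rw [e, (dotForm m).iteratedFDeriv_comp_right h0 y (by exact_mod_cast le_top)]
  refine (ContinuousMultilinearMap.norm_compContinuousLinearMap_le _ _).trans ?_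
  rw [norm_iteratedFDeriv_eq_norm_iteratedDeriv, iteratedDeriv_cexp_mul_ofReal]
  have h1 : ‖Complex.exp (2 * Real.pi * Complex.I * (dotForm m y : ℝ))‖ = 1 := by
    rw [← mFourier_proj, norm_mFourier_apply]
  rw [norm_mul, h1, Finset.prod_const, Finset.card_univ, Fintype.card_fin, norm_pow, mul_one,
    ← mul_pow, ← mul_pow]
  have h2 := norm_dotForm_le m
  have h3 : ‖(2 * Real.pi * Complex.I : ℂ)‖ = 2 * Real.pi := by simp [abs_of_pos Real.pi_pos]
  rw [h3, mul_assoc (2 * Real.pi)]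
  gcongr

theorem smoothTorus_tsum {s : (Fin n → ℤ) → ℂ} (hs : ∀ M : ℕ, ∃ C : ℝ, ∀ m, ‖s m‖ * wt m ^ M ≤ C) :
    SmoothTorus fun x => ∑' m, s m * mFourier m x := by
  choose C hC using hs
  refine contDiff_tsum (N := ⊤)
    (v := fun i m => (2 * Real.pi * n) ^ i * (‖s m‖ * wt m ^ i))
    (fun m => contDiff_const.mul (contDiff_mFourier_proj m)) (fun i _ => ?_) fun i m y _ => ?_
  · refine Summable.mul_left _ ?_
    refine ((summable_wt n).mul_left (C (i + 2 * n))).of_nonneg_of_le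
      (fun m => by have := wt_pos m; positivity) fun m => ?_
    rw [← div_eq_mul_inv, le_div_iff₀ (pow_pos (wt_pos m) _), mul_assoc, ← pow_add]
    exact hC _ m
  · have e : (fun y : Fin n → ℝ => s m * mFourier m fun j => (y j : UnitAddCircle)) =
        fun y => s m • mFourier m (proj y) := rfl
    rw [e, iteratedFDeriv_const_smul_apply'
      ((contDiff_mFourier_proj m).contDiffAt.of_le (by exact_mod_cast le_top)), norm_smul]
    have := norm_iteratedFDeriv_mFourier_le m i y
    calc ‖s m‖ * _ ≤ ‖s m‖ * ((2 * Real.pi * n) ^ i * wt m ^ i) := by gcongr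
      _ = _ := by ring

theorem coef_tsum {s : (Fin n → ℤ) → ℂ} (hs : Summable fun m => ‖s m‖) (m : Fin n → ℤ) :
    coef (fun x => ∑' k, s k * mFourier k x) m = s m := by
  have h := hasSum_integral_of_summable_integral_norm (μ := torusMeasure n)
    (F := fun (k : Fin n → ℤ) x => mFourier (-m) x * (s k * mFourier k x))
    (fun k => integrable_mFourier_mul (by fun_prop) _)
    (by simpa [norm_mFourier_apply] using hs)
  have h2 : ∀ k, ∫ x, mFourier (-m) x * (s k * mFourier k x) ∂(torusMeasure n) =
      if k = m then s m else 0 := fun k => by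
    change coef (fun x => s k * mFourier k x) m = _
    rw [coef_const_mul, coef_mFourier]
    split_ifs with hk
    · rw [hk, mul_one]
    · rw [mul_zero]
  simp only [h2] at h
  have h3 := h.unique (hasSum_ite_eq m (s m))
  rw [← h3, coef]
  congr 1
  funext x
  exact tsum_mul_left.symm

/-! ### Fourier coefficients of an amplitude -/

theorem rpow_le_rpow_abs {x y : ℝ} (hx : 1 ≤ x) (hxy : x ≤ y) (s : ℝ) : x ^ s ≤ y ^ |s| :=
  (Real.rpow_le_rpow_of_exponent_le hx (le_abs_self s)).trans
    (Real.rpow_le_rpow (by linarith) hxy (abs_nonneg s))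

theorem rpow_neg_abs_le {x y : ℝ} (hx : 1 ≤ x) (hxy : x ≤ y) (s : ℝ) : y ^ (-|s|) ≤ x ^ s :=
  (Real.rpow_le_rpow_of_nonpos (by linarith) hxy (by simp)).trans
    (Real.rpow_le_rpow_of_exponent_le hx (neg_abs_le s))

/-- Comparable positive numbers have comparable real powers. -/
theorem rpow_le_of_comparable {x y : ℝ} (hy : 0 < y) (h1 : y / 2 ≤ x) (h2 : x ≤ 2 * y) (s : ℝ) :
    x ^ s ≤ 2 ^ |s| * y ^ s := by
  have hx : 0 < x := by linarith
  rcases le_total 0 s with hs | hs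
  · rw [abs_of_nonneg hs, ← Real.mul_rpow (by norm_num) hy.le]
    exact Real.rpow_le_rpow hx.le h2 hs
  · rw [abs_of_nonpos hs, Real.rpow_neg (by norm_num), ← Real.inv_rpow (by norm_num),
      ← Real.mul_rpow (by norm_num) hy.le]
    exact Real.rpow_le_rpow_of_nonpos (by positivity) (by linarith) hs

theorem SmoothTorus.diff_diff {a : (Fin n → ℤ) → (Fin n → ℤ) → UnitAddTorus (Fin n) → ℂ}
    (ha : ∀ k l, SmoothTorus (a k l)) (p q : Fin n → ℕ) (k l : Fin n → ℤ) :
    SmoothTorus fun z => PsiDO.diff p (fun k' => PsiDO.diff q (fun l' => a k' l' z) l) k :=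
  SmoothTorus.diff (F := fun k' z => PsiDO.diff q (fun l' => a k' l' z) l)
    (fun k' => SmoothTorus.diff (F := a k') (ha k') q l) p k

theorem coef_diff_diff {a : (Fin n → ℤ) → (Fin n → ℤ) → UnitAddTorus (Fin n) → ℂ}
    (ha : ∀ k l, SmoothTorus (a k l)) (p q : Fin n → ℕ) (k l m : Fin n → ℤ) :
    coef (fun z => diff p (fun k' => diff q (fun l' => a k' l' z) l) k) m =
      diff p (fun k' => diff q (fun l' => coef (a k' l') m) l) k := by
  rw [coef_diff (F := fun k' z => diff q (fun l' => a k' l' z) l)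
    fun k' => (SmoothTorus.diff (F := a k') (ha k') q l).continuous]
  congr 1
  funext k'
  exact coef_diff (F := a k') (fun l' => (ha k' l').continuous) q l m

/-- Integrating by parts `M` times costs at most `max (1 + |k|) (1 + |l|) ^ (δ M)`, whatever the
distribution of the loss between the two frequencies. -/
theorem IsAmplitude.norm_coef_le {μ₁ μ₂ ρ δ : ℝ} (hδ : 0 ≤ δ)
    {a : (Fin n → ℤ) → (Fin n → ℤ) → UnitAddTorus (Fin n) → ℂ} (ha : IsAmplitude μ₁ μ₂ ρ δ a)
    (p q : Fin n → ℕ) (M : ℕ) : ∃ C : ℝ, 0 < C ∧ ∀ k l m : Fin n → ℤ,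
      ‖diff p (fun k' => diff q (fun l' => coef (a k' l') m) l) k‖ * wt m ^ M ≤
        C * (wt k ^ (μ₁ - ρ * mlen p) * wt l ^ (μ₂ - ρ * mlen q) *
          max (wt k) (wt l) ^ (δ * M)) := by
  obtain ⟨C₀, hC₀, h⟩ := norm_coef_le_of_mpd n M
  choose C hC J hJ hb using fun γ => ha.2 p q γ
  refine ⟨C₀ * ∑ γ ∈ multiLT n (M + 1), C γ,
    mul_pos hC₀ (Finset.sum_pos (fun γ _ => hC γ) ⟨0, (mem_multiLT _).mpr (by simp)⟩),
    fun k l m => ?_⟩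
  rw [← coef_diff_diff ha.1, mul_assoc C₀]
  refine h _ (SmoothTorus.diff_diff ha.1 p q k l) _ (fun γ hγ y => (hb γ k l y).trans ?_) m
  have hk := wt_pos k
  have hl := wt_pos l
  have hJ' : (J γ : ℝ) ≤ mlen γ := by exact_mod_cast hJ γ
  have hγ' : (mlen γ : ℝ) ≤ M := by exact_mod_cast hγ
  have h1 : wt k ^ (δ * J γ) * wt l ^ (δ * ((mlen γ : ℝ) - J γ)) ≤
      max (wt k) (wt l) ^ (δ * M) := by
    have hm : 1 ≤ max (wt k) (wt l) := le_max_of_le_left (one_le_wt k)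
    calc wt k ^ (δ * J γ) * wt l ^ (δ * ((mlen γ : ℝ) - J γ))
        ≤ max (wt k) (wt l) ^ (δ * J γ) * max (wt k) (wt l) ^ (δ * ((mlen γ : ℝ) - J γ)) := by
          gcongr
          · exact le_max_left _ _
          · exact le_max_right _ _
      _ = max (wt k) (wt l) ^ (δ * mlen γ) := by
          rw [← Real.rpow_add (by linarith)]; congr 1; ring
      _ ≤ _ := Real.rpow_le_rpow_of_exponent_le hm (by gcongr)
  have h2 : C γ ≤ ∑ γ ∈ multiLT n (M + 1), C γ :=
    Finset.single_le_sum (fun γ _ => (hC γ).le) ((mem_multiLT γ).mpr (Nat.lt_succ_of_le hγ))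
  have h3 := (hC γ).le.trans h2
  rw [Real.rpow_add hk, Real.rpow_add hl]
  calc C γ * (wt k ^ (μ₁ - ρ * mlen p) * wt k ^ (δ * J γ)) *
        (wt l ^ (μ₂ - ρ * mlen q) * wt l ^ (δ * ((mlen γ : ℝ) - J γ)))
      = C γ * (wt k ^ (μ₁ - ρ * mlen p) * wt l ^ (μ₂ - ρ * mlen q) *
        (wt k ^ (δ * J γ) * wt l ^ (δ * ((mlen γ : ℝ) - J γ)))) := by ring
    _ ≤ _ := by gcongr

/-- Near the diagonal `l = k`, where the frequency increment is at most half of the weight of `k`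
and all weights on the Newton path are comparable to it, the Newton remainder gains
`(1 + |k|) ^ (-N (ρ - δ))`. -/
theorem norm_newtonRem_near {ν₁ ν₂ ρ δ : ℝ} (hδ : 0 ≤ δ)
    {d : (Fin n → ℤ) → (Fin n → ℤ) → (Fin n → ℤ) → ℂ}
    (hd : ∀ (α : Fin n → ℕ) (M : ℕ), ∃ C : ℝ, 0 < C ∧ ∀ k l m : Fin n → ℤ,
      ‖diff α (fun l' => d k l' m) l‖ * wt m ^ M ≤
        C * (wt k ^ ν₁ * wt l ^ (ν₂ - ρ * mlen α) * max (wt k) (wt l) ^ (δ * M)))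
    (N M : ℕ) : ∃ C : ℝ, 0 < C ∧ ∀ k m : Fin n → ℤ, (lone m : ℝ) ≤ wt k / 2 →
      ‖newtonRem N (fun l => d k l m) k m‖ * wt m ^ M ≤
        C * wt k ^ (ν₁ + ν₂ - N * (ρ - δ) + δ * M) := by
  -- `N` extra derivatives pay for the factor `|m|₁ ^ N` in the Newton remainder
  choose C hC h using fun α => hd α (N + M)
  let S := ∑ α ∈ multiLT n (N + 1), C α
  have hS : 0 < S := Finset.sum_pos (fun γ _ => hC γ) ⟨0, (mem_multiLT _).mpr (by simp)⟩
  let K : ℝ := 2 ^ |ν₂ - ρ * N| * 2 ^ (δ * (N + M : ℕ))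
  have hK : 0 < K := by positivity
  refine ⟨(1 + n) ^ N * (S * K), by positivity, fun k m hm => ?_⟩
  have hk := wt_pos k
  have hwm := wt_pos m
  let B : ℝ := S * K * wt k ^ (ν₁ + ν₂ - N * (ρ - δ) + δ * M) / wt m ^ (N + M)
  have hB0 : 0 ≤ B := by positivity
  have hB : ∀ α, mlen α = N → ∀ p, lone p ≤ lone m →
      ‖diff α (fun l => d k l m) (k + p)‖ ≤ B := by
    intro α hα p hp
    have hp' : (lone p : ℝ) ≤ wt k / 2 := le_trans (by exact_mod_cast hp) hm
    have h1 : wt k / 2 ≤ wt (k + p) := by have := wt_le_add_lone k p; linarith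
    have h2 : wt (k + p) ≤ 2 * wt k := by have := wt_add_le_lone k p; linarith
    have h3 : max (wt k) (wt (k + p)) ≤ 2 * wt k := max_le (by linarith) h2
    have hCα : C α ≤ S :=
      Finset.single_le_sum (fun γ _ => (hC γ).le) ((mem_multiLT α).mpr (by omega))
    have h4 := h α k (k + p) m
    have h5 := rpow_le_of_comparable hk h1 h2 (ν₂ - ρ * N)
    have h6 : max (wt k) (wt (k + p)) ^ (δ * (N + M : ℕ)) ≤
        2 ^ (δ * (N + M : ℕ)) * wt k ^ (δ * (N + M : ℕ)) := by
      rw [← Real.mul_rpow (by norm_num) hk.le]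
      exact Real.rpow_le_rpow (le_max_of_le_left hk.le) h3 (by positivity)
    rw [hα] at h4
    rw [le_div_iff₀ (by positivity)]
    have h7 : wt k ^ (ν₁ + ν₂ - N * (ρ - δ) + δ * M) =
        wt k ^ ν₁ * wt k ^ (ν₂ - ρ * N) * wt k ^ (δ * (N + M : ℕ)) := by
      rw [← Real.rpow_add hk, ← Real.rpow_add hk]
      congr 1
      push_cast
      ring
    have h8 := wt_pos (k + p)
    calc _ ≤ _ := h4
      _ ≤ S * (wt k ^ ν₁ * (2 ^ |ν₂ - ρ * N| * wt k ^ (ν₂ - ρ * N)) *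
          (2 ^ (δ * (N + M : ℕ)) * wt k ^ (δ * (N + M : ℕ)))) := by gcongr
      _ = _ := by rw [h7]; simp only [K]; ring
  have h1 := norm_newtonRem_le N (fun l => d k l m) k (lone m) B hB0 hB m le_rfl
  have h2 : (lone m : ℝ) ≤ (1 + n) * wt m := by have := lone_le m; linarith
  calc _ ≤ ((lone m : ℝ) ^ N * B) * wt m ^ M := by gcongr
    _ ≤ (((1 + n) * wt m) ^ N * B) * wt m ^ M := by gcongr
    _ = _ := by
      simp only [B, mul_pow, pow_add]
      field_simp

/-- Away from the diagonal the weight of the increment dominates all other weights, and the decay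
of the Fourier coefficients, of rate `1 - δ > 0` per derivative, absorbs every power. -/
theorem norm_newtonRem_far {ν₁ ν₂ ρ δ : ℝ} (hδ : 0 ≤ δ) (hδ1 : δ < 1) (hρ : 0 ≤ ρ)
    {d : (Fin n → ℤ) → (Fin n → ℤ) → (Fin n → ℤ) → ℂ}
    (hd : ∀ (α : Fin n → ℕ) (M : ℕ), ∃ C : ℝ, 0 < C ∧ ∀ k l m : Fin n → ℤ,
      ‖diff α (fun l' => d k l' m) l‖ * wt m ^ M ≤
        C * (wt k ^ ν₁ * wt l ^ (ν₂ - ρ * mlen α) * max (wt k) (wt l) ^ (δ * M)))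
    (N M : ℕ) (b : ℝ) : ∃ C : ℝ, 0 < C ∧ ∀ k m : Fin n → ℤ, wt k / 2 < lone m →
      ‖newtonRem N (fun l => d k l m) k m‖ * wt m ^ M ≤ C * wt k ^ b := by
  let e : ℝ := |ν₁| + (|ν₂| + ρ * N)
  -- with `L` derivatives, `(1 + |m|) ^ (-(1 - δ) L)` beats all the powers of weights that occur
  obtain ⟨L, hL⟩ := exists_nat_ge ((N + e + M + |b|) / (1 - δ))
  rw [div_le_iff₀ (by linarith)] at hL
  choose C hC h using fun α => hd α L
  choose C' hC' h' using norm_mfall_le (n := n)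
  let A : ℝ := 2 * n + 1
  have hA : 1 ≤ A := by simp only [A]; linarith [(Nat.cast_nonneg n : (0 : ℝ) ≤ n)]
  let S := C 0 + ∑ α ∈ multiLT n N, C' α * C α
  have hS : 0 < S := add_pos_of_pos_of_nonneg (hC 0)
    (Finset.sum_nonneg fun α _ => (mul_pos (hC' α) (hC α)).le)
  refine ⟨S * A ^ (e + δ * L + |b|), by positivity, fun k m hm => ?_⟩
  have hk := one_le_wt k
  have hwm := one_le_wt m
  have hkA : wt k ≤ A * wt m := by have := lone_le m; simp only [A]; linarith
  have hkmA : wt (k + m) ≤ A * wt m := by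
    have := lone_le m; have := wt_add_le k m; simp only [A]; linarith
  have hAm : 1 ≤ A * wt m := one_le_mul_of_one_le_of_one_le hA hwm
  have bd : ∀ α, mlen α ≤ N → ∀ l, wt l ≤ A * wt m →
      ‖diff α (fun l' => d k l' m) l‖ * wt m ^ L ≤ C α * (A * wt m) ^ (e + δ * L) := by
    intro α hα l hl
    have hα' : ρ * (mlen α : ℝ) ≤ ρ * N := by gcongr
    refine (h α k l m).trans ?_
    have h1 := rpow_le_rpow_abs hk hkA ν₁
    have h2 : wt l ^ (ν₂ - ρ * mlen α) ≤ (A * wt m) ^ (|ν₂| + ρ * N) := by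
      refine (rpow_le_rpow_abs (one_le_wt l) hl _).trans
        (Real.rpow_le_rpow_of_exponent_le hAm ((abs_sub _ _).trans ?_))
      rw [abs_of_nonneg (by positivity : 0 ≤ ρ * (mlen α : ℝ))]
      linarith
    have h3 : max (wt k) (wt l) ^ (δ * L) ≤ (A * wt m) ^ (δ * L) :=
      Real.rpow_le_rpow (le_max_of_le_left (by linarith)) (max_le hkA hl) (by positivity)
    have h4 : (A * wt m) ^ (e + δ * L) =
        (A * wt m) ^ |ν₁| * (A * wt m) ^ (|ν₂| + ρ * N) * (A * wt m) ^ (δ * L) := by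
      rw [← Real.rpow_add (by linarith), ← Real.rpow_add (by linarith)]
    rw [h4]
    have := hC α
    have := wt_pos l
    gcongr
  have tot : ‖newtonRem N (fun l => d k l m) k m‖ * wt m ^ L ≤
      S * wt m ^ N * (A * wt m) ^ (e + δ * L) := by
    have hpow : 1 ≤ wt m ^ N := one_le_pow₀ hwm
    have h1 : ‖d k (k + m) m‖ * wt m ^ L ≤ C 0 * wt m ^ N * (A * wt m) ^ (e + δ * L) := by
      have := bd 0 (by simp) (k + m) hkmA
      rw [diff_zero] at this
      refine this.trans ?_
      have := hC 0
      gcongr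
      exact le_mul_of_one_le_right this.le hpow
    have h2 : ∀ α ∈ multiLT n N,
        ‖mfall α m / mfact α * diff α (fun l => d k l m) k‖ * wt m ^ L ≤
          C' α * C α * wt m ^ N * (A * wt m) ^ (e + δ * L) := by
      intro α hα
      have hα := (mem_multiLT α).mp hα
      have h3 := bd α hα.le k hkA
      have h4 : ‖mfall α m / mfact α‖ ≤ C' α * wt m ^ N := by
        rw [norm_div, Complex.norm_natCast]
        refine (div_le_self (norm_nonneg _) ?_).trans ((h' α m).trans ?_)
        · exact_mod_cast Nat.one_le_iff_ne_zero.mpr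
            (Finset.prod_ne_zero_iff.mpr fun j _ => Nat.factorial_ne_zero _)
        · have := hC' α
          gcongr
      rw [norm_mul, mul_assoc]
      have := hC' α
      calc _ ≤ (C' α * wt m ^ N) * (C α * (A * wt m) ^ (e + δ * L)) := by gcongr
        _ = _ := by ring
    rw [newtonRem]
    calc _ ≤ (‖d k (k + m) m‖ +
          ∑ α ∈ multiLT n N, ‖mfall α m / mfact α * diff α (fun l => d k l m) k‖) * wt m ^ L := by
          gcongr
          exact (norm_sub_le _ _).trans (by gcongr; exact norm_sum_le _ _)
      _ = ‖d k (k + m) m‖ * wt m ^ L + ∑ α ∈ multiLT n N,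
          ‖mfall α m / mfact α * diff α (fun l => d k l m) k‖ * wt m ^ L := by
          rw [add_mul, Finset.sum_mul]
      _ ≤ _ := add_le_add h1 (Finset.sum_le_sum h2)
      _ = _ := by simp only [S, add_mul, Finset.sum_mul]
  have hw0 : 0 < wt m := by linarith
  have hA0 : 0 < A := by linarith
  have hb := rpow_neg_abs_le hk hkA b
  have hfin : wt m ^ N * (A * wt m) ^ (e + δ * L) * wt m ^ M ≤
      A ^ (e + δ * L + |b|) * (A * wt m) ^ (-|b|) * wt m ^ L := by
    have h1 : wt m ^ N * (A * wt m) ^ (e + δ * L) * wt m ^ M =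
        A ^ (e + δ * L) * wt m ^ (N + e + M + δ * L) := by
      rw [Real.mul_rpow hA0.le hw0.le, ← Real.rpow_natCast, ← Real.rpow_natCast,
        show (N : ℝ) + e + M + δ * L = N + (e + δ * L) + M by ring,
        Real.rpow_add hw0 (N + (e + δ * L)), Real.rpow_add hw0 (N : ℝ)]
      ring
    have h2 : A ^ (e + δ * L + |b|) * (A * wt m) ^ (-|b|) * wt m ^ L =
        A ^ (e + δ * L) * wt m ^ (L - |b|) := by
      rw [Real.mul_rpow hA0.le hw0.le, ← Real.rpow_natCast, sub_eq_neg_add, Real.rpow_add hw0,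
        show A ^ (e + δ * L) = A ^ (e + δ * L + |b|) * A ^ (-|b|) by
          rw [← Real.rpow_add hA0]; congr 1; ring]
      ring
    rw [h1, h2]
    gcongr
    linarith
  have hLpos : 0 < wt m ^ L := pow_pos hw0 L
  rw [← mul_le_mul_iff_left₀ hLpos]
  calc ‖newtonRem N (fun l => d k l m) k m‖ * wt m ^ M * wt m ^ L
      = (‖newtonRem N (fun l => d k l m) k m‖ * wt m ^ L) * wt m ^ M := by ring
    _ ≤ (S * wt m ^ N * (A * wt m) ^ (e + δ * L)) * wt m ^ M := by gcongr
    _ = S * (wt m ^ N * (A * wt m) ^ (e + δ * L) * wt m ^ M) := by ring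
    _ ≤ S * (A ^ (e + δ * L + |b|) * (A * wt m) ^ (-|b|) * wt m ^ L) := by gcongr
    _ ≤ S * (A ^ (e + δ * L + |b|) * wt k ^ b * wt m ^ L) := by gcongr
    _ = _ := by ring

theorem diff_newtonRem (N : ℕ) (q : Fin n → ℕ) (τ : (Fin n → ℤ) → ℂ) (l m : Fin n → ℤ) :
    diff q (fun l => newtonRem N τ l m) l = newtonRem N (diff q τ) l m := by
  simp only [newtonRem]
  rw [diff_sub, diff_comp_add, diff_finset_sum]
  congr 1
  refine Finset.sum_congr rfl fun α _ => ?_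
  rw [diff_const_mul, diff_diff, diff_diff, add_comm]

theorem diff_newtonRem_param (N : ℕ) (p : Fin n → ℕ) (F : (Fin n → ℤ) → (Fin n → ℤ) → ℂ)
    (k l m : Fin n → ℤ) :
    diff p (fun k' => newtonRem N (F k') l m) k =
      newtonRem N (fun l' => diff p (fun k' => F k' l') k) l m := by
  simp only [newtonRem]
  rw [diff_sub, diff_finset_sum]
  congr 1
  refine Finset.sum_congr rfl fun α _ => ?_
  rw [diff_const_mul, ← diff_diff_comm]

/-- The Fourier coefficients of the remainder `σ_A - ∑_{|α|<N}` and their differences in `k`. -/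
theorem IsAmplitude.norm_diff_newtonRem_le {μ₁ μ₂ ρ δ : ℝ} (hδ : 0 ≤ δ) (hδ1 : δ < 1)
    (hρ : 0 ≤ ρ) {a : (Fin n → ℤ) → (Fin n → ℤ) → UnitAddTorus (Fin n) → ℂ}
    (ha : IsAmplitude μ₁ μ₂ ρ δ a) (α : Fin n → ℕ) (N M : ℕ) : ∃ C : ℝ, 0 < C ∧
      ∀ k m : Fin n → ℤ,
        ‖diff α (fun k' => newtonRem N (fun l => coef (a k' l) m) k' m) k‖ * wt m ^ M ≤
          C * wt k ^ (μ₁ + μ₂ - ρ * mlen α - N * (ρ - δ) + δ * M) := by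
  have key : ∀ p q : Fin n → ℕ, ∃ C : ℝ, 0 < C ∧ ∀ k m : Fin n → ℤ,
      ‖newtonRem N (fun l => diff p (fun k' => diff q (fun l' => coef (a k' l') m) l) k) k m‖ *
        wt m ^ M ≤ C * wt k ^ (μ₁ - ρ * mlen p + (μ₂ - ρ * mlen q) - N * (ρ - δ) + δ * M) := by
    intro p q
    have hd : ∀ (α : Fin n → ℕ) (M : ℕ), ∃ C : ℝ, 0 < C ∧ ∀ k l m : Fin n → ℤ,
      ‖diff α (fun l => diff p (fun k' => diff q (fun l' => coef (a k' l') m) l) k) l‖ *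
        wt m ^ M ≤ C * (wt k ^ (μ₁ - ρ * mlen p) * wt l ^ (μ₂ - ρ * mlen q - ρ * mlen α) *
          max (wt k) (wt l) ^ (δ * M)) := by
      intro α M
      obtain ⟨C, hC, h⟩ := ha.norm_coef_le hδ p (α + q) M
      refine ⟨C, hC, fun k l m => ?_⟩
      have := h k l m
      rw [← diff_diff_comm]
      simp only [← diff_diff] at this
      rw [mlen_add, Nat.cast_add, mul_add, add_comm (ρ * (mlen α : ℝ)), ← sub_sub] at this
      exact this
    obtain ⟨C₁, hC₁, h₁⟩ := norm_newtonRem_near hδ hd N M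
    obtain ⟨C₂, hC₂, h₂⟩ := norm_newtonRem_far hδ hδ1 hρ hd N M
      (μ₁ - ρ * mlen p + (μ₂ - ρ * mlen q) - N * (ρ - δ) + δ * M)
    refine ⟨C₁ + C₂, by positivity, fun k m => ?_⟩
    have hk := wt_pos k
    rw [add_mul]
    rcases le_or_gt (lone m : ℝ) (wt k / 2) with hm | hm
    · exact (h₁ k m hm).trans (le_add_of_nonneg_right (by positivity))
    · exact (h₂ k m hm).trans (le_add_of_nonneg_left (by positivity))
  obtain ⟨ι, _, p, q, hpq, h⟩ := diff_diagonal α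
  choose C hC hb using fun i => key (p i) (q i)
  refine ⟨1 + ∑ i, C i, by have := Finset.sum_nonneg fun i (_ : i ∈ Finset.univ) => (hC i).le
                           linarith, fun k m => ?_⟩
  have hk := wt_pos k
  rw [h fun k l => newtonRem N (fun l => coef (a k l) m) l m]
  simp only [diff_newtonRem, diff_newtonRem_param]
  calc _ ≤ (∑ i, ‖newtonRem N (fun l' => diff (p i)
        (fun k' => diff (q i) (fun l => coef (a k' l) m) l') k) k m‖) * wt m ^ M := by
        have := wt_pos m
        gcongr
        exact norm_sum_le _ _
    _ ≤ ∑ i, C i * wt k ^ (μ₁ + μ₂ - ρ * mlen α - N * (ρ - δ) + δ * M) := by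
        rw [Finset.sum_mul]
        refine Finset.sum_le_sum fun i _ => (hb i k m).trans ?_
        have h1 : (mlen α : ℝ) ≤ mlen (p i) + mlen (q i) := by exact_mod_cast hpq i
        have h2 := mul_le_mul_of_nonneg_left h1 hρ
        have := hC i
        gcongr
        · exact one_le_wt k
        · linarith
    _ ≤ _ := by
        rw [← Finset.sum_mul]
        gcongr
        linarith

/-! ### Symbol classes and the terms of the expansion -/

theorem mpd_add {f g : UnitAddTorus (Fin n) → ℂ} (hf : SmoothTorus f) (hg : SmoothTorus g)
    (β : Fin n → ℕ) : mpd β (fun x => f x + g x) = fun x => mpd β f x + mpd β g x := by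
  refine ((hf.add hg).mpd β).ext ((hf.mpd β).add (hg.mpd β)) fun m => ?_
  rw [coef_mpd (hf.add hg), coef_add hf.continuous hg.continuous,
    coef_add (hf.mpd β).continuous (hg.mpd β).continuous, coef_mpd hf, coef_mpd hg, mul_add]

theorem IsSymbol.add {μ ρ δ : ℝ} {σ τ : (Fin n → ℤ) → UnitAddTorus (Fin n) → ℂ}
    (hσ : IsSymbol μ ρ δ σ) (hτ : IsSymbol μ ρ δ τ) :
    IsSymbol μ ρ δ fun k x => σ k x + τ k x := by
  refine ⟨fun k => (hσ.1 k).add (hτ.1 k), fun α β => ?_⟩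
  obtain ⟨C₁, hC₁, h₁⟩ := hσ.2 α β
  obtain ⟨C₂, hC₂, h₂⟩ := hτ.2 α β
  refine ⟨C₁ + C₂, by positivity, fun k x => ?_⟩
  simp only [diff_add]
  rw [mpd_add (SmoothTorus.diff hσ.1 α k) (SmoothTorus.diff hτ.1 α k), add_mul]
  exact (norm_add_le _ _).trans (add_le_add (h₁ k x) (h₂ k x))

theorem IsSymbol.mono {μ ν ρ δ : ℝ} {σ : (Fin n → ℤ) → UnitAddTorus (Fin n) → ℂ}
    (hσ : IsSymbol μ ρ δ σ) (h : μ ≤ ν) : IsSymbol ν ρ δ σ := by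
  refine ⟨hσ.1, fun α β => ?_⟩
  obtain ⟨C, hC, hb⟩ := hσ.2 α β
  refine ⟨C, hC, fun k x => (hb k x).trans ?_⟩
  gcongr
  exact one_le_wt k

theorem isSymbol_zero (μ ρ δ : ℝ) :
    IsSymbol μ ρ δ (fun (_ : Fin n → ℤ) (_ : UnitAddTorus (Fin n)) => (0 : ℂ)) := by
  have h0 : SmoothTorus fun _ : UnitAddTorus (Fin n) => (0 : ℂ) :=
    (contDiff_const : ContDiff ℝ ∞ fun _ : Fin n → ℝ => (0 : ℂ))
  have hd : ∀ (α : Fin n → ℕ) k, diff α (fun _ => (0 : ℂ)) k = 0 := fun α k => by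
    simpa using diff_const_mul α 0 (fun _ => 0) k
  refine ⟨fun _ => h0, fun α β => ⟨1, one_pos, fun k x => ?_⟩⟩
  have hm : mpd β (fun _ : UnitAddTorus (Fin n) => (0 : ℂ)) = fun _ => 0 :=
    (h0.mpd β).ext h0 fun m => by rw [coef_mpd h0]; simp [coef]
  simp only [hd, hm, norm_zero]
  have := wt_pos k
  positivity

theorem IsSymbol.sum {ι : Type*} (s : Finset ι) {μ ρ δ : ℝ}
    {σ : ι → (Fin n → ℤ) → UnitAddTorus (Fin n) → ℂ} (h : ∀ i ∈ s, IsSymbol μ ρ δ (σ i)) :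
    IsSymbol μ ρ δ fun k x => ∑ i ∈ s, σ i k x := by
  classical
  induction s using Finset.induction_on with
  | empty => simpa using isSymbol_zero μ ρ δ
  | insert i s hi ih =>
    simp only [Finset.sum_insert hi]
    exact (h i (Finset.mem_insert_self i s)).add
      (ih fun j hj => h j (Finset.mem_insert_of_mem hj))

/-- The term of index `γ` of the expansion. -/
noncomputable def ampTermExp (a : (Fin n → ℤ) → (Fin n → ℤ) → UnitAddTorus (Fin n) → ℂ)
    (γ : Fin n → ℕ) (k : Fin n → ℤ) (x : UnitAddTorus (Fin n)) : ℂ :=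
  (1 / (mfact γ : ℂ)) * diff γ (fun l => mpd γ (a k l) x) k

theorem smoothTorus_ampTermExp {a : (Fin n → ℤ) → (Fin n → ℤ) → UnitAddTorus (Fin n) → ℂ}
    (ha : ∀ k l, SmoothTorus (a k l)) (γ : Fin n → ℕ) (k : Fin n → ℤ) :
    SmoothTorus (ampTermExp a γ k) :=
  (SmoothTorus.diff (F := fun l => mpd γ (a k l)) (fun l => (ha k l).mpd γ) γ k).const_mul _

theorem coef_ampTermExp {a : (Fin n → ℤ) → (Fin n → ℤ) → UnitAddTorus (Fin n) → ℂ}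
    (ha : ∀ k l, SmoothTorus (a k l)) (γ : Fin n → ℕ) (k m : Fin n → ℤ) :
    coef (ampTermExp a γ k) m =
      mfall γ m / mfact γ * diff γ (fun l => coef (a k l) m) k := by
  unfold ampTermExp
  rw [coef_const_mul, coef_diff (F := fun l => mpd γ (a k l))
    fun l => ((ha k l).mpd γ).continuous]
  simp only [coef_mpd (ha _ _)]
  rw [diff_const_mul]
  ring

/-- The term of index `γ` of the expansion is a symbol of order `μ₁ + μ₂ - |γ| (ρ - δ)`: the
product `D_x^{(β)} D_x^{(γ)}` is a combination of operators `D_x^{(γ')}` with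
`|γ'| ≤ |β| + |γ|`, and on the diagonal the two weights of the amplitude estimate agree. -/
theorem isSymbol_ampTermExp {μ₁ μ₂ ρ δ : ℝ} (hδ : 0 ≤ δ) (hρ : 0 ≤ ρ)
    {a : (Fin n → ℤ) → (Fin n → ℤ) → UnitAddTorus (Fin n) → ℂ} (ha : IsAmplitude μ₁ μ₂ ρ δ a)
    (γ : Fin n → ℕ) :
    IsSymbol (μ₁ + μ₂ - mlen γ * (ρ - δ)) ρ δ (ampTermExp a γ) := by
  refine ⟨smoothTorus_ampTermExp ha.1 γ, fun α β => ?_⟩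
  obtain ⟨ι, _, p, q, hpq, hdiag⟩ := diff_diagonal α
  obtain ⟨s, κ, hs, hκ⟩ := mfall_mul_mfall β γ
  let G : ι → (Fin n → ℤ) → UnitAddTorus (Fin n) → ℂ := fun i k z =>
    diff (p i) (fun k' => diff (q i + γ) (fun l' => a k' l' z) k) k
  have hG : ∀ i k, SmoothTorus (G i k) := fun i k =>
    SmoothTorus.diff_diff ha.1 (p i) (q i + γ) k k
  have hrhs : ∀ k, SmoothTorus fun x => ∑ i, ∑ η ∈ s, (1 / (mfact γ : ℂ) * κ η) *
      mpd η (G i k) x := fun k =>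
    SmoothTorus.sum _ fun i _ => SmoothTorus.sum _ fun η _ => ((hG i k).mpd η).const_mul _
  have key : ∀ k, mpd β (fun y => diff α (fun k' => ampTermExp a γ k' y) k) =
      fun x => ∑ i, ∑ η ∈ s, (1 / (mfact γ : ℂ) * κ η) * mpd η (G i k) x := by
    intro k
    have hl := SmoothTorus.diff (smoothTorus_ampTermExp ha.1 γ) α k
    refine (hl.mpd β).ext (hrhs k) fun m => ?_
    rw [coef_mpd hl, coef_diff fun k => (smoothTorus_ampTermExp ha.1 γ k).continuous,
      coef_sum _ fun i _ => (SmoothTorus.sum _ fun η _ =>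
        ((hG i k).mpd η).const_mul _).continuous]
    have e1 : diff α (fun k' => coef (ampTermExp a γ k') m) k =
        mfall γ m / mfact γ * ∑ i, coef (G i k) m := by
      simp only [coef_ampTermExp ha.1]
      rw [diff_const_mul, hdiag fun k l => diff γ (fun l' => coef (a k l') m) l]
      congr 1
      refine Finset.sum_congr rfl fun i _ => ?_
      rw [coef_diff_diff ha.1]
      congr 1
      funext k'
      rw [← diff_diff]
    have e2 : ∀ i, coef (fun x => ∑ η ∈ s, (1 / (mfact γ : ℂ) * κ η) * mpd η (G i k) x) m =
        (mfall β m * mfall γ m / mfact γ) * coef (G i k) m := by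
      intro i
      rw [coef_sum _ fun η _ => (((hG i k).mpd η).const_mul _).continuous, hκ]
      simp only [coef_const_mul, coef_mpd (hG i k), Finset.sum_div, Finset.sum_mul]
      exact Finset.sum_congr rfl fun η _ => by ring
    simp only [e1, e2, Finset.mul_sum]
    exact Finset.sum_congr rfl fun i _ => by ring
  choose C hC J hJ hb using fun i η => ha.2 (p i) (q i + γ) η
  have hsum : 0 ≤ ∑ i, ∑ η ∈ s, ‖1 / (mfact γ : ℂ) * κ η‖ * C i η :=
    Finset.sum_nonneg fun i _ => Finset.sum_nonneg fun η _ =>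
      mul_nonneg (norm_nonneg _) (hC i η).le
  refine ⟨1 + ∑ i, ∑ η ∈ s, ‖1 / (mfact γ : ℂ) * κ η‖ * C i η, by linarith, fun k x => ?_⟩
  have hk := wt_pos k
  rw [key]
  have hterm : ∀ i, ∀ η ∈ s, ‖mpd η (G i k) x‖ ≤
      C i η * wt k ^ (μ₁ + μ₂ - mlen γ * (ρ - δ) - ρ * mlen α + δ * mlen β) := by
    intro i η hη
    refine (hb i η k k x).trans ?_
    rw [mul_assoc, ← Real.rpow_add hk]
    have h1 : (mlen α : ℝ) ≤ mlen (p i) + mlen (q i) := by exact_mod_cast hpq i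
    have h2 : (mlen η : ℝ) ≤ mlen β + mlen γ := by exact_mod_cast hs η hη
    have h3 := mul_le_mul_of_nonneg_left h1 hρ
    have h4 := mul_le_mul_of_nonneg_left h2 hδ
    refine mul_le_mul_of_nonneg_left (wt_rpow_le k ?_) (hC i η).le
    rw [mlen_add]
    push_cast
    linarith
  calc _ ≤ ∑ i, ∑ η ∈ s, ‖(1 / (mfact γ : ℂ) * κ η) * mpd η (G i k) x‖ :=
        (norm_sum_le _ _).trans (Finset.sum_le_sum fun i _ => norm_sum_le _ _)
    _ ≤ ∑ i, ∑ η ∈ s, ‖1 / (mfact γ : ℂ) * κ η‖ * C i η *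
          wt k ^ (μ₁ + μ₂ - mlen γ * (ρ - δ) - ρ * mlen α + δ * mlen β) := by
        refine Finset.sum_le_sum fun i _ => Finset.sum_le_sum fun η hη => ?_
        rw [norm_mul, mul_assoc]
        gcongr
        exact hterm i η hη
    _ = (∑ i, ∑ η ∈ s, ‖1 / (mfact γ : ℂ) * κ η‖ * C i η) *
          wt k ^ (μ₁ + μ₂ - mlen γ * (ρ - δ) - ρ * mlen α + δ * mlen β) := by
        simp only [Finset.sum_mul]
    _ ≤ _ := by gcongr; linarith

/-! ### The symbol of an amplitude operator -/

/-- The symbol of the operator with amplitude `a`: its `m`-th Fourier coefficient at `k` is that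
of `a (k, k + m, ·)`. -/
noncomputable def ampSymbol (a : (Fin n → ℤ) → (Fin n → ℤ) → UnitAddTorus (Fin n) → ℂ)
    (k : Fin n → ℤ) (x : UnitAddTorus (Fin n)) : ℂ :=
  ∑' m, coef (a k (k + m)) m * mFourier m x

theorem newtonRem_zero (τ : (Fin n → ℤ) → ℂ) (k m : Fin n → ℤ) :
    newtonRem 0 τ k m = τ (k + m) := by
  have h0 : multiLT n 0 = ∅ := by ext α; simp [mem_multiLT]
  simp [newtonRem, h0]

section

variable {μ₁ μ₂ ρ δ : ℝ} {a : (Fin n → ℤ) → (Fin n → ℤ) → UnitAddTorus (Fin n) → ℂ}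

theorem IsAmplitude.coef_decay (hδ : 0 ≤ δ) (hδ1 : δ < 1) (hρ : 0 ≤ ρ)
    (ha : IsAmplitude μ₁ μ₂ ρ δ a) (k : Fin n → ℤ) (M : ℕ) :
    ∃ C : ℝ, ∀ m, ‖coef (a k (k + m)) m‖ * wt m ^ M ≤ C := by
  obtain ⟨C, -, h⟩ := ha.norm_diff_newtonRem_le hδ hδ1 hρ 0 0 M
  refine ⟨C * wt k ^ (μ₁ + μ₂ - ρ * mlen (0 : Fin n → ℕ) - (0 : ℕ) * (ρ - δ) + δ * M),
    fun m => ?_⟩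
  have := h k m
  rwa [diff_zero, newtonRem_zero] at this

theorem IsAmplitude.smoothTorus_ampSymbol (hδ : 0 ≤ δ) (hδ1 : δ < 1) (hρ : 0 ≤ ρ)
    (ha : IsAmplitude μ₁ μ₂ ρ δ a) (k : Fin n → ℤ) : SmoothTorus (ampSymbol a k) :=
  smoothTorus_tsum fun M => ha.coef_decay hδ hδ1 hρ k M

theorem IsAmplitude.coef_ampSymbol (hδ : 0 ≤ δ) (hδ1 : δ < 1) (hρ : 0 ≤ ρ)
    (ha : IsAmplitude μ₁ μ₂ ρ δ a) (k m : Fin n → ℤ) :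
    coef (ampSymbol a k) m = coef (a k (k + m)) m :=
  coef_tsum (s := fun m => coef (a k (k + m)) m)
    (summable_of_wt_decay (ha.coef_decay hδ hδ1 hρ k (2 * n)).choose_spec) m

theorem ampExpansion_eq (N : ℕ) (k : Fin n → ℤ) (x : UnitAddTorus (Fin n)) :
    ampExpansion a N k x = ∑ γ ∈ multiLT n N, ampTermExp a γ k x := rfl

/-- The remainder is a symbol up to a loss of order `2nδ` that does not depend on `N`; the loss
comes from bounding the sup norm by the `ℓ¹` norm of the Fourier coefficients. -/
theorem IsAmplitude.isSymbol_remainder_of_loss (hδ : 0 ≤ δ) (hδ1 : δ < 1) (hρ : 0 ≤ ρ)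
    (ha : IsAmplitude μ₁ μ₂ ρ δ a) (N : ℕ) :
    IsSymbol (μ₁ + μ₂ - N * (ρ - δ) + δ * (2 * n)) ρ δ
      fun k x => ampSymbol a k x - ampExpansion a N k x := by
  have hs := ha.smoothTorus_ampSymbol hδ hδ1 hρ
  have hE : ∀ k, SmoothTorus (ampExpansion a N k) := fun k =>
    SmoothTorus.sum _ fun γ _ => smoothTorus_ampTermExp ha.1 γ k
  have hh : ∀ k, SmoothTorus fun x => ampSymbol a k x - ampExpansion a N k x :=
    fun k => (hs k).sub (hE k)
  have hcoef : ∀ k m, coef (fun x => ampSymbol a k x - ampExpansion a N k x) m =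
      newtonRem N (fun l => coef (a k l) m) k m := by
    intro k m
    rw [coef_sub (hs k).continuous (hE k).continuous, ha.coef_ampSymbol hδ hδ1 hρ]
    have e : ampExpansion a N k = fun x => ∑ γ ∈ multiLT n N, ampTermExp a γ k x := rfl
    rw [e, coef_sum _ fun γ _ => (smoothTorus_ampTermExp ha.1 γ k).continuous]
    simp only [coef_ampTermExp ha.1, newtonRem]
  refine ⟨hh, fun α β => ?_⟩
  obtain ⟨C₁, hC₁, h₁⟩ := norm_mfall_le β
  obtain ⟨C₂, hC₂, h₂⟩ := ha.norm_diff_newtonRem_le hδ hδ1 hρ α N (mlen β + 2 * n)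
  have hW : 0 ≤ ∑' m : Fin n → ℤ, (wt m ^ (2 * n))⁻¹ :=
    tsum_nonneg fun m => inv_nonneg.mpr (pow_nonneg (wt_pos m).le _)
  refine ⟨1 + C₁ * C₂ * ∑' m : Fin n → ℤ, (wt m ^ (2 * n))⁻¹, by positivity, fun k x => ?_⟩
  have hf := SmoothTorus.diff hh α k
  have hk := wt_pos k
  let b : ℝ := μ₁ + μ₂ - ρ * mlen α - N * (ρ - δ) + δ * (mlen β + 2 * n : ℕ)
  have hb : μ₁ + μ₂ - N * (ρ - δ) + δ * (2 * n) - ρ * mlen α + δ * mlen β = b := by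
    simp only [b]; push_cast; ring
  have hbound : ∀ m, ‖coef (mpd β fun y => diff α
      (fun k' => ampSymbol a k' y - ampExpansion a N k' y) k) m‖ ≤
      C₁ * C₂ * wt k ^ b * (wt m ^ (2 * n))⁻¹ := by
    intro m
    have hm := wt_pos m
    rw [coef_mpd hf, coef_diff fun k => (hh k).continuous, norm_mul, ← div_eq_mul_inv,
      le_div_iff₀ (by positivity)]
    simp only [hcoef]
    have h3 := h₂ k m
    calc _ ≤ (C₁ * wt m ^ mlen β) *
          ‖diff α (fun k' => newtonRem N (fun l => coef (a k' l) m) k' m) k‖ * wt m ^ (2 * n) := by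
          gcongr; exact h₁ m
      _ = C₁ * (‖diff α (fun k' => newtonRem N (fun l => coef (a k' l) m) k' m) k‖ *
          wt m ^ (mlen β + 2 * n)) := by rw [pow_add]; ring
      _ ≤ C₁ * (C₂ * wt k ^ b) := by gcongr
      _ = _ := by ring
  rw [hb]
  calc _ ≤ _ := (hf.mpd β).norm_le_tsum_coef x
    _ ≤ ∑' m : Fin n → ℤ, C₁ * C₂ * wt k ^ b * (wt m ^ (2 * n))⁻¹ :=
        (hf.mpd β).summable_coef.tsum_le_tsum hbound ((summable_wt n).mul_left _)
    _ = (C₁ * C₂ * ∑' m : Fin n → ℤ, (wt m ^ (2 * n))⁻¹) * wt k ^ b := by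
        rw [tsum_mul_left]; ring
    _ ≤ _ := by gcongr; linarith

/-- The loss is removed by expanding to a higher order: the additional terms are symbols of the
right order by `isSymbol_ampTermExp`. -/
theorem IsAmplitude.isSymbol_remainder (hδ : 0 ≤ δ) (hδρ : δ < ρ) (hρ : ρ ≤ 1)
    (ha : IsAmplitude μ₁ μ₂ ρ δ a) (N : ℕ) :
    IsSymbol (μ₁ + μ₂ - N * (ρ - δ)) ρ δ
      fun k x => ampSymbol a k x - ampExpansion a N k x := by
  have hδ1 : δ < 1 := hδρ.trans_le hρ
  have hρ0 : 0 ≤ ρ := hδ.trans hδρ.le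
  have hpos : 0 < ρ - δ := sub_pos.mpr hδρ
  obtain ⟨L, hL⟩ := exists_nat_ge (δ * (2 * n) / (ρ - δ))
  rw [div_le_iff₀ hpos] at hL
  have hsub : multiLT n N ⊆ multiLT n (N + L) := fun γ hγ => by
    rw [mem_multiLT] at hγ ⊢; omega
  have h1 : IsSymbol (μ₁ + μ₂ - N * (ρ - δ)) ρ δ
      fun k x => ampSymbol a k x - ampExpansion a (N + L) k x :=
    (ha.isSymbol_remainder_of_loss hδ hδ1 hρ0 (N + L)).mono (by push_cast; linarith)
  have h2 : IsSymbol (μ₁ + μ₂ - N * (ρ - δ)) ρ δ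
      fun k x => ∑ γ ∈ multiLT n (N + L) \ multiLT n N, ampTermExp a γ k x := by
    refine IsSymbol.sum _ fun γ hγ => (isSymbol_ampTermExp hδ hρ0 ha γ).mono ?_
    have h3 : N ≤ mlen γ := by
      simp only [Finset.mem_sdiff, mem_multiLT] at hγ; omega
    have h4 : (N : ℝ) ≤ mlen γ := by exact_mod_cast h3
    gcongr
  convert h1.add h2 using 3 with k x
  simp only [ampExpansion_eq]
  rw [← Finset.sum_sdiff hsub]
  ring

/-! ### The operator identity -/

theorem ampTerm_eq (f : (Fin n → ℤ) → ℂ) (k l : Fin n → ℤ) :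
    ampTerm a f k l = f l * coef (a k l) (l - k) := by
  rw [ampTerm, coef, neg_sub, ← integral_const_mul]
  congr 1
  funext x
  ring

theorem hasSum_coef_mul_latticeFourier {g : UnitAddTorus (Fin n) → ℂ} (hg : Continuous g)
    {f : (Fin n → ℤ) → ℂ} (hf : Summable fun l => ‖f l‖) (k : Fin n → ℤ) :
    HasSum (fun l => f l * coef g (l - k))
      (∫ x, mFourier k x * g x * latticeFourier f x ∂(torusMeasure n)) := by
  obtain ⟨B, hB⟩ := isCompact_univ.exists_bound_of_continuousOn hg.continuousOn
  have hB' : ∀ x, ‖g x‖ ≤ B := fun x => hB x (Set.mem_univ x)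
  have hint : ∀ l : Fin n → ℤ, Integrable
      (fun x => mFourier k x * (g x * (mFourier (-l) x * f l))) (torusMeasure n) :=
    fun l => integrable_mFourier_mul (by fun_prop) _
  have hnorm : ∀ (l : Fin n → ℤ) (x : UnitAddTorus (Fin n)),
      ‖mFourier k x * (g x * (mFourier (-l) x * f l))‖ ≤ B * ‖f l‖ := by
    intro l x
    rw [norm_mul, norm_mul, norm_mul, norm_mFourier_apply, norm_mFourier_apply, one_mul, one_mul]
    gcongr
    exact hB' x
  have h := hasSum_integral_of_summable_integral_norm hint (by
    refine (hf.mul_left B).of_nonneg_of_le (fun l => integral_nonneg fun x => norm_nonneg _)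
      fun l => ?_
    refine (integral_mono (hint l).norm (integrable_const (B * ‖f l‖)) (hnorm l)).trans ?_
    simp)
  have e1 : ∀ l, ∫ x, mFourier k x * (g x * (mFourier (-l) x * f l)) ∂(torusMeasure n) =
      f l * coef g (l - k) := by
    intro l
    rw [coef, neg_sub, ← integral_const_mul]
    congr 1
    funext x
    rw [sub_eq_add_neg, mFourier_add]
    ring
  have e2 : ∀ x, ∑' l, mFourier k x * (g x * (mFourier (-l) x * f l)) =
      mFourier k x * g x * latticeFourier f x := fun x => by
    rw [tsum_mul_left, tsum_mul_left, mul_assoc]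
    rfl
  simpa only [e1, e2] using h

theorem IsAmplitude.summable_ampTerm (hδ : 0 ≤ δ) (hδ1 : δ < 1) (hρ : 0 ≤ ρ)
    (ha : IsAmplitude μ₁ μ₂ ρ δ a) {f : (Fin n → ℤ) → ℂ} (hf : Summable fun l => ‖f l‖)
    (k : Fin n → ℤ) : Summable fun l => ‖ampTerm a f k l‖ := by
  obtain ⟨C, hC⟩ := ha.coef_decay hδ hδ1 hρ k 0
  refine (hf.mul_right C).of_nonneg_of_le (fun l => norm_nonneg _) fun l => ?_
  rw [ampTerm_eq, norm_mul]
  gcongr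
  simpa using hC (l - k)

theorem IsAmplitude.opAmplitude_eq (hδ : 0 ≤ δ) (hδ1 : δ < 1) (hρ : 0 ≤ ρ)
    (ha : IsAmplitude μ₁ μ₂ ρ δ a) {f : (Fin n → ℤ) → ℂ} (hf : Summable fun l => ‖f l‖)
    (k : Fin n → ℤ) : opAmplitude a f k = opSymbol (ampSymbol a) f k := by
  rw [opSymbol, opAmplitude,
    ← (hasSum_coef_mul_latticeFourier (ha.smoothTorus_ampSymbol hδ hδ1 hρ k).continuous hf
      k).tsum_eq]
  refine tsum_congr fun l => ?_
  rw [ampTerm_eq, ha.coef_ampSymbol hδ hδ1 hρ, add_sub_cancel]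

end

end PsiDO

theorem theorem2p6 (n : ℕ) (μ₁ μ₂ ρ δ : ℝ) (hδ : 0 ≤ δ) (hδρ : δ < ρ) (hρ : ρ ≤ 1)
    (a : (Fin n → ℤ) → (Fin n → ℤ) → UnitAddTorus (Fin n) → ℂ)
    (ha : PsiDO.IsAmplitude μ₁ μ₂ ρ δ a) :
    ∃ σ : (Fin n → ℤ) → UnitAddTorus (Fin n) → ℂ,
      PsiDO.IsSymbol (μ₁ + μ₂) ρ δ σ ∧
      (∀ f : (Fin n → ℤ) → ℂ, Summable (fun l => ‖f l‖) → ∀ k : Fin n → ℤ,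
        Summable (fun l => ‖PsiDO.ampTerm a f k l‖) ∧
        PsiDO.opAmplitude a f k = PsiDO.opSymbol σ f k) ∧
      ∀ N : ℕ, PsiDO.IsSymbol (μ₁ + μ₂ - (N : ℝ) * (ρ - δ)) ρ δ
        (fun k x => σ k x - PsiDO.ampExpansion a N k x) := by
  have hδ1 : δ < 1 := hδρ.trans_le hρ
  have hρ0 : 0 ≤ ρ := hδ.trans hδρ.le
  refine ⟨PsiDO.ampSymbol a, ?_, fun f hf k => ⟨ha.summable_ampTerm hδ hδ1 hρ0 hf k,
    ha.opAmplitude_eq hδ hδ1 hρ0 hf k⟩, ha.isSymbol_remainder hδ hδρ hρ⟩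
  have h := ha.isSymbol_remainder hδ hδρ hρ 0
  have h0 : PsiDO.multiLT n 0 = ∅ := by ext α; simp [PsiDO.mem_multiLT]
  simpa [PsiDO.ampExpansion, h0] using h
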